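/- Let $X$ be a connected compact Riemann surface of genus $g$, $\alpha_1,\dots,\alpha_g$ a basis of the space $\Omega^1$ of holomorphic differentials, orthonormal for $\frac i2\int_X\alpha\wedge\overline\beta$, $S^*\subset X$ a finite set, and $\mu$ an admissible current, i.e. a smooth volume form of total mass $1$ or a delta current $\delta_a$, $a\in X$. Let $G$ be a Green function of $\mu$: a real solution on $X\times X$, smooth outside of the diagonal (and of $\{a\}\times X\cup X\times\{a\}$ if $\mu=\delta_a$), with logarithmic singularities there, of $$\frac1{2\pi i}\overline\partial\partial G=\delta_\Delta-\Bigl(p_1^*\mu+p_2^*\mu-\frac i2\sum_k(p_1^*\alpha_k\wedge p_2^*\overline\alpha_k+p_2^*\alpha_k\wedge p_1^*\overline\alpha_k)\Bigr);$$ its value on the singular divisor is set to $0$. For functions $\varphi_0,\dots,\varphi_r$ put $$\omega_r(\varphi_0,\dots,\varphi_r)=\frac1{(r+1)!}\mathrm{Alt}_{r+1}\sum_{k=0}^r(-1)^k\varphi_0\,\partial\varphi_1\wedge\dots\wedge\partial\varphi_k\wedge\overline\partial\varphi_{k+1}\wedge\dots\wedge\overline\partial\varphi_r.$$ Let $V^\vee=\mathbb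 C[S^*]\oplus(\Omega^1\oplus\overline{\Omega^1})$. Let $T$ be a plane trivalent tree with $m+1$ ends, decorated clockwise by $v_0,\dots,v_m$, each $v_i$ being a generator $\{s\}$, $s\in S^*$, or a one-form in $\Omega^1\oplus\overline{\Omega^1}$. An end decorated by $\{s\}$ is placed at the point $s$. To an edge $E$ whose ends are internal vertices or $\{s\}$-decorated assign the function $G_E=G(x,y)$ of its two end points; to an edge with an end decorated by a one-form $\eta$ assign the form $G_E=\eta$ on the copy of $X$ of its internal vertex. Put $$\kappa_T=\mathrm{sgn}(E_0\wedge\dots\wedge E_{2m-2})\;\omega_r(G_{E_0},\dots,G_{E_r})\wedge G_{E_{r+1}}\wedge\dots\wedge G_{E_{2m-2}},$$ where $E_0,\dots,E_r$ are the edges of the first kind, $E_{r+1},\dots,E_{2m-2}$ those of the second kind, and the sign compares this ordering with the canonical (clockwise) orientation of the plane tree. (If there is no edge of the first kind, or if a tree with a single edge has an end decorated by a one-form, put $\kappa_T=0$.) The Hodge correlator of the cyclic word is $$\mathrm{Cor}_{\mathcal H}\,\mathcal C(v_0\otimes\dots\otimes v_m)=\sum_T\int_{X^{\{\text{internal vertices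 of }T\}}}\kappa_T,$$ the sum being over all plane trivalent trees decorated by the word. It is extended by linearity, from the words in the $\{s\}$, $s\in S^*$, and the elements of a basis of $\Omega^1\oplus\overline{\Omega^1}$, to the cyclic envelope $\mathcal C^\vee_{X,S^*}=A^+/[A^+,A^+]$ of the tensor algebra $A=T(V^\vee)$, where $A^+$ is the augmentation ideal. Let $\mathcal{CL}ie^\vee_{X,S^*}$ be the quotient of $\mathcal C^\vee_{X,S^*}$ by the subspace generated by all elements $\sum_{\sigma\in\Sigma_{p,q}}\mathcal C(v_0\otimes v_{\sigma(1)}\otimes\dots\otimes v_{\sigma(p+q)})$, $v_i\in V^\vee$, $p,q\ge1$; here $\Sigma_{p,q}$ is the set of $(p,q)$-shuffles, i.e. of the permutations $\sigma$ such that $1,\dots,p$ occur in this order in the sequence $\sigma(1),\dots,\sigma(p+q)$, and so do $p+1,\dots,p+q$. Then $\mathrm{Cor}_{\mathcal H}$ is a well defined linear map $\mathcal C^\vee_{X,S^*}\to\mathbb C$, and for all $p,q\ge1$ and $v_0,\dots,v_{p+q}\in V^\vee$ $$\sum_{\sigma\in\Sigma_{p,q}}\mathrm{Cor}_{\mathcal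 H}\,\mathcal C(v_0\otimes v_{\sigma(1)}\otimes\dots\otimes v_{\sigma(p+q)})=0;$$ the same relation holds for the tree sums themselves when each $v_i$ is a point of $S^*$ or an arbitrary one-form in $\Omega^1\oplus\overline{\Omega^1}$. Hence $\mathrm{Cor}_{\mathcal H}$ descends to a unique linear map $\mathcal{CL}ie^\vee_{X,S^*}\to\mathbb C$. -/

import Mathlib

open MeasureTheory
open scoped Manifold ContDiff

noncomputable section

namespace HodgeCorrelator

/-! ### Charts, one-forms and integration on a compact Riemann surface -/

section Surface

variable (X : Type*) [TopologicalSpace X] [ChartedSpace ℂ X]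

/-- The charts of the atlas of `X`. -/
abbrev Chart : Type _ := ↥(atlas ℂ X)

variable {X} in
/-- The coordinate change from the chart `e` to the chart `e'`. -/
def transition (e e' : Chart X) (z : ℂ) : ℂ := e'.1 (e.1.symm z)

/-- Holomorphic differentials `Ω¹(X)`: in every chart `e` the differential is `f e z dz`, the
coefficient `f e` being holomorphic on the image of the chart (and, by convention, `0` outside of
it), with the usual transformation law under coordinate changes. -/
def holForms : Submodule ℂ (Chart X → ℂ → ℂ) where
  carrier := {f | (∀ e, DifferentiableOn ℂ (f e) e.1.target) ∧
    (∀ e, ∀ z ∉ e.1.target, f e z = 0) ∧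
    ∀ e e', ∀ z ∈ e.1.target, e.1.symm z ∈ e'.1.source →
      f e z = f e' (transition e e' z) * deriv (transition e e') z}
  zero_mem' := ⟨fun _ => differentiableOn_const 0, fun _ _ _ => rfl, fun _ _ _ _ _ => by simp⟩
  add_mem' := by
    rintro f g ⟨hf, hf0, hf'⟩ ⟨hg, hg0, hg'⟩
    refine ⟨fun e => (hf e).add (hg e), fun e z hz => ?_, fun e e' z hz hz' => ?_⟩
    · simp [hf0 e z hz, hg0 e z hz]
    · simp [hf' e e' z hz hz', hg' e e' z hz hz', add_mul]
  smul_mem' := by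
    rintro c f ⟨hf, hf0, hf'⟩
    refine ⟨fun e => (hf e).const_smul c, fun e z hz => ?_, fun e e' z hz hz' => ?_⟩
    · simp [hf0 e z hz]
    · simp [hf' e e' z hz hz', mul_assoc]

/-- Antiholomorphic differentials, i.e. the complex conjugates of the holomorphic ones: in every
chart `e` the differential is `f e z dz̄`. -/
def antiholForms : Submodule ℂ (Chart X → ℂ → ℂ) where
  carrier := {f | (fun e z => (starRingEnd ℂ) (f e z)) ∈ holForms X}
  zero_mem' := by
    have : (fun (e : Chart X) (z : ℂ) => (starRingEnd ℂ) ((0 : Chart X → ℂ → ℂ) e z)) = 0 := by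
      ext; simp
    simp only [Set.mem_ofPred_eq, this, zero_mem]
  add_mem' := by
    intro f g hf hg
    have : (fun (e : Chart X) (z : ℂ) => (starRingEnd ℂ) ((f + g) e z)) =
        (fun e z => (starRingEnd ℂ) (f e z)) + fun e z => (starRingEnd ℂ) (g e z) := by
      ext; simp
    simp only [Set.mem_ofPred_eq, this]
    exact add_mem hf hg
  smul_mem' := by
    intro c f hf
    have : (fun (e : Chart X) (z : ℂ) => (starRingEnd ℂ) ((c • f) e z)) =
        (starRingEnd ℂ) c • fun e z => (starRingEnd ℂ) (f e z) := by
      ext; simp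
    simp only [Set.mem_ofPred_eq, this]
    exact Submodule.smul_mem _ _ hf

/-- The space `Ω¹(X) ⊕ Ω̄¹(X) = H¹(X, ℂ)` of harmonic one-forms. -/
abbrev OneForms : Type _ := holForms X × antiholForms X

variable [CompactSpace X] [MeasurableSpace X] [BorelSpace X]

theorem exists_chartSel : ∃ c : X → Chart X, (∀ x, x ∈ (c x).1.source) ∧
    (Set.range c).Finite ∧ ∀ e, MeasurableSet (c ⁻¹' {e}) := by
  classical
  obtain ⟨t, ht⟩ := isCompact_univ.elim_finite_subcover
    (fun x : X => (chartAt ℂ x).source) (fun x => (chartAt ℂ x).open_source)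
    (fun x _ => Set.mem_iUnion.2 ⟨x, mem_chart_source ℂ x⟩)
  set l := t.toList with hl
  have hcov : ∀ x : X, ∃ n : ℕ, ∃ h : n < l.length, x ∈ (chartAt ℂ l[n]).source := by
    intro x
    obtain ⟨y, hy, hxy⟩ := Set.mem_iUnion₂.1 (ht (Set.mem_univ x))
    obtain ⟨n, hn, rfl⟩ := List.getElem_of_mem (Finset.mem_toList.2 hy)
    exact ⟨n, hn, hxy⟩
  let N : X → ℕ := fun x => Nat.find (hcov x)
  have hN : ∀ x, N x < l.length := fun x => (Nat.find_spec (hcov x)).1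
  let d : Fin l.length → Chart X := fun n => ⟨chartAt ℂ l[n.1], chart_mem_atlas ℂ _⟩
  have hopen : ∀ n : ℕ, MeasurableSet
      {x : X | ∃ h : n < l.length, x ∈ (chartAt ℂ l[n]).source} := by
    intro n
    by_cases h : n < l.length
    · simpa [h] using (chartAt ℂ l[n]).open_source.measurableSet
    · simp [h]
  have hNm : Measurable N := measurable_find hcov hopen
  refine ⟨fun x => d ⟨N x, hN x⟩, fun x => (Nat.find_spec (hcov x)).2, ?_, fun e => ?_⟩
  · exact (Set.finite_range d).subset (by rintro _ ⟨x, rfl⟩; exact ⟨_, rfl⟩)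
  · have : (fun x => d ⟨N x, hN x⟩) ⁻¹' {e} = N ⁻¹' {n | ∃ h : n < l.length, d ⟨n, h⟩ = e} := by
      ext x
      simp [hN x]
    rw [this]
    exact hNm trivial

/-- A choice, for every point `x` of `X`, of a chart around `x`, taking finitely many values, each
of them on a Borel set. The integrals below do not depend on it. -/
def chartSel : X → Chart X := (exists_chartSel X).choose

/-- The measure on `X` which is Lebesgue measure `dx dy` in the chart `e` on the Borel set where
`e` is selected. A top degree form on a power of `X` is integrated by integrating its coefficients
in the selected charts against the powers of this measure. -/
def chartMeasure : Measure X :=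
  ∑ e ∈ (exists_chartSel X).choose_spec.2.1.toFinset,
    ((volume : Measure ℂ).restrict
      (e.1.target ∩ e.1.symm ⁻¹' (chartSel X ⁻¹' {e}))).map e.1.symm

variable {X} in
/-- The coefficient at `x` of a tensor `f`, in the chart selected at `x`. -/
def coeffAt {R : Type*} (f : Chart X → ℂ → R) (x : X) : R := f (chartSel X x) ((chartSel X x).1 x)

variable {X} in
/-- Orthonormality for `⟨α, β⟩ = (i/2) ∫_X α ∧ β̄`, where `(i/2) dz ∧ dz̄ = dx ∧ dy`. -/
def IsOrthonormal {g : ℕ} (α : Fin g → holForms X) : Prop :=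
  ∀ k l, ∫ x, coeffAt (α k).1 x * (starRingEnd ℂ) (coeffAt (α l).1 x) ∂(chartMeasure X) =
    if k = l then 1 else 0

/-- A smooth volume form of total mass one on `X`, written `dens e z dx ∧ dy` in the chart `e`. -/
structure VolumeForm where
  /-- the density in a chart -/
  dens : Chart X → ℂ → ℝ
  smooth : ∀ e, ContDiffOn ℝ ∞ (dens e) e.1.target
  pos : ∀ e, ∀ z ∈ e.1.target, 0 < dens e z
  trans : ∀ e e', ∀ z ∈ e.1.target, e.1.symm z ∈ e'.1.source →
    dens e z = dens e' (transition e e' z) * ‖deriv (transition e e') z‖ ^ 2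
  mass : ∫ x, coeffAt dens x ∂(chartMeasure X) = 1

/-- Admissible currents: smooth volume forms of mass one and delta currents of points. -/
inductive AdmissibleCurrent
  | vol (m : VolumeForm X)
  | delta (a : X)

variable {X}

/-- The density of `μ` outside of its singular support. -/
def AdmissibleCurrent.dens : AdmissibleCurrent X → Chart X → ℂ → ℝ
  | .vol m => m.dens
  | .delta _ => 0

/-- The singular divisor of the Green function of `μ`: the diagonal, together with
`{a} × X ∪ X × {a}` when `μ = δ_a`. -/
def AdmissibleCurrent.divisor : AdmissibleCurrent X → Set (X × X)
  | .vol _ => {p | p.1 = p.2}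
  | .delta a => {p | p.1 = p.2 ∨ p.1 = a ∨ p.2 = a}

open Classical in
/-- The logarithmic singularity of the Green function of `μ` near the point `(x₀, y₀)`. -/
def AdmissibleCurrent.logSing (μ : AdmissibleCurrent X) (x₀ y₀ x y : X) : ℝ :=
  (if x₀ = y₀ then Real.log (‖chartAt ℂ x₀ x - chartAt ℂ x₀ y‖ ^ 2) else 0) -
  match μ with
  | .vol _ => 0
  | .delta a =>
    (if x₀ = a then Real.log (‖chartAt ℂ a x - chartAt ℂ a a‖ ^ 2) else 0) +
    (if y₀ = a then Real.log (‖chartAt ℂ a y - chartAt ℂ a a‖ ^ 2) else 0)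

end Surface

/-! ### Differential forms in coordinates on a power `X ^ V` -/

section Forms

variable (V : Type*)

/-- Complex valued (real linear) covectors on `ℂ ^ V`. -/
abbrev Cov : Type _ := (V → ℂ) →ₗ[ℝ] ℂ

/-- Complex valued exterior forms on `ℂ ^ V`. -/
abbrev ExtForm : Type _ := ExteriorAlgebra ℂ (Cov V)

variable {V} [Fintype V]

/-- Multiplication by `i` on tangent vectors. -/
def mulI : (V → ℂ) →ₗ[ℝ] (V → ℂ) := (LinearMap.lsmul ℂ (V → ℂ) Complex.I).restrictScalars ℝ

/-- `∂f` at `z`. -/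
def del (f : (V → ℂ) → ℂ) (z : V → ℂ) : Cov V :=
  (1 / 2 : ℂ) • ((fderiv ℝ f z).toLinearMap -
    Complex.I • ((fderiv ℝ f z).toLinearMap ∘ₗ mulI))

/-- `∂̄f` at `z`. -/
def delbar (f : (V → ℂ) → ℂ) (z : V → ℂ) : Cov V :=
  (1 / 2 : ℂ) • ((fderiv ℝ f z).toLinearMap +
    Complex.I • ((fderiv ℝ f z).toLinearMap ∘ₗ mulI))

/-- The form `ω_m(φ₀, …, φ_m)` at `z`:
`1/(m+1)! Alt (∑_{k=0}^m (-1)^k φ₀ ∂φ₁ ∧ … ∧ ∂φ_k ∧ ∂̄φ_{k+1} ∧ … ∧ ∂̄φ_m)`. -/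
def omegaForm {m : ℕ} (φ : Fin (m + 1) → (V → ℂ) → ℂ) (z : V → ℂ) : ExtForm V :=
  (1 / ((m + 1).factorial : ℂ)) • ∑ σ : Equiv.Perm (Fin (m + 1)),
    ((Equiv.Perm.sign σ : ℤ) : ℂ) • ∑ k ∈ Finset.range (m + 1),
      ((-1 : ℂ) ^ k * φ (σ 0) z) • (List.ofFn fun j : Fin m =>
        ExteriorAlgebra.ι ℂ
          (if (j : ℕ) < k then del (φ (σ j.succ)) z else delbar (φ (σ j.succ)) z)).prod

/-- `ω_r(φ₀, …, φ_r)` for a list of functions (for the empty list there is no such form, and the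
value is `0`). -/
def omegaList (z : V → ℂ) : List ((V → ℂ) → ℂ) → ExtForm V
  | [] => 0
  | f :: fs => omegaForm (m := fs.length) (fun i => (f :: fs).get i) z

open Classical in
/-- The positively oriented real frame `e₁, i e₁, e₂, i e₂, …` of `ℂ ^ V`. The orientation does not
depend on the enumeration of `V`. -/
def frame (k : Fin (Fintype.card V * 2)) : V → ℂ :=
  Pi.single ((Fintype.equivFin V).symm (finProdFinEquiv.symm k).1)
    (if (finProdFinEquiv.symm k).2 = 0 then 1 else Complex.I)

/-- The values of a covector on the frame. -/
def evalFrame : Cov V →ₗ[ℂ] (Fin (Fintype.card V * 2) → ℂ) where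
  toFun θ k := θ (frame k)
  map_add' _ _ := rfl
  map_smul' _ _ := rfl

/-- The coefficient of the top degree part of a form with respect to `dx₁ ∧ dy₁ ∧ dx₂ ∧ dy₂ ∧ …`,
i.e. its value on the positively oriented frame. -/
def topCoeff : ExtForm V →ₗ[ℂ] ℂ :=
  ExteriorAlgebra.liftAlternating
    (Pi.single (Fintype.card V * 2) (Matrix.detRowAlternating.compLinearMap evalFrame))

end Forms

/-! ### Green functions -/

section Green

variable {X : Type*} [TopologicalSpace X] [ChartedSpace ℂ X]

/-- The expression of a real function on `X ^ V` in local coordinates. -/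
def localRep {V : Type*} (F : (V → X) → ℝ) (c : V → Chart X) (z : V → ℂ) : ℂ :=
  (F fun v => (c v).1.symm (z v) : ℝ)

/-- `∂f/∂z_j`. -/
def dz (j : Fin 2) (f : (Fin 2 → ℂ) → ℂ) (z : Fin 2 → ℂ) : ℂ := del f z (Pi.single j 1)

/-- `∂f/∂z̄_j`. -/
def dzbar (j : Fin 2) (f : (Fin 2 → ℂ) → ℂ) (z : Fin 2 → ℂ) : ℂ := delbar f z (Pi.single j 1)

variable [CompactSpace X] [MeasurableSpace X] [BorelSpace X]

/-- `G` is a Green function of the admissible current `μ`, i.e. a solution of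
`(2πi)⁻¹ ∂̄∂ G = δ_Δ - (p₁^*μ + p₂^*μ - (i/2) ∑_k (p₁^*α_k ∧ p₂^*ᾱ_k + p₂^*α_k ∧ p₁^*ᾱ_k))`
on `X × X`: it is smooth outside of the singular divisor, has the logarithmic singularities along
the divisor which produce the delta currents on the right hand side (`(2πi)⁻¹ ∂̄∂ log |t|²` is the
delta current of `t = 0`), and satisfies the equation outside of the divisor. The four components
of the equation are the coefficients of `dz̄₀ ∧ dz₀`, `dz̄₁ ∧ dz₁`, `dz̄₁ ∧ dz₀`, `dz̄₀ ∧ dz₁`.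
On the divisor the value of `G` is set to `0`. -/
structure IsGreenFunction (μ : AdmissibleCurrent X) {g : ℕ} (α : Fin g → holForms X)
    (G : X → X → ℝ) : Prop where
  eq_zero : ∀ p ∈ μ.divisor, G p.1 p.2 = 0
  local_form : ∀ x₀ y₀ : X, ∃ h : ℂ × ℂ → ℝ,
    ContDiffAt ℝ ∞ h (chartAt ℂ x₀ x₀, chartAt ℂ y₀ y₀) ∧
    ∀ᶠ p in nhds (x₀, y₀), p ∉ μ.divisor →
      G p.1 p.2 = μ.logSing x₀ y₀ p.1 p.2 + h (chartAt ℂ x₀ p.1, chartAt ℂ y₀ p.2)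
  equation : ∀ (c : Fin 2 → Chart X) (z : Fin 2 → ℂ), (∀ j, z j ∈ (c j).1.target) →
    ((c 0).1.symm (z 0), (c 1).1.symm (z 1)) ∉ μ.divisor →
    let f := localRep (fun x : Fin 2 → X => G (x 0) (x 1)) c
    dzbar 0 (dz 0 f) z = -Real.pi * μ.dens (c 0) (z 0) ∧
    dzbar 1 (dz 1 f) z = -Real.pi * μ.dens (c 1) (z 1) ∧
    dzbar 1 (dz 0 f) z =
      Real.pi * ∑ k, (α k).1 (c 0) (z 0) * (starRingEnd ℂ) ((α k).1 (c 1) (z 1)) ∧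
    dzbar 0 (dz 1 f) z =
      Real.pi * ∑ k, (α k).1 (c 1) (z 1) * (starRingEnd ℂ) ((α k).1 (c 0) (z 0))

end Green

/-! ### Decorated plane trivalent trees -/

section Trees

/-- A plane trivalent tree with one distinguished end (the root), the other ends being decorated
by elements of `L`: the edge at the root ends either in another end of the tree, or in an internal
vertex, from which a left and a right subtree grow (the three edges at the vertex being, clockwise:
the edge towards the root, the left one, the right one). -/
inductive PlaneTree (L : Type*)
  | leaf (l : L) : PlaneTree L
  | node (left right : PlaneTree L) : PlaneTree L

variable {L : Type*}

/-- The decorations of the ends, in clockwise order starting from (and omitting) the root. -/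
def PlaneTree.ends : PlaneTree L → List L
  | .leaf l => [l]
  | .node s t => s.ends ++ t.ends

/-- There are finitely many plane trivalent trees with given decorations of the ends. -/
theorem PlaneTree.finite_ends_eq (w : List L) : Finite {T : PlaneTree L // T.ends = w} := by
  have hne : ∀ T : PlaneTree L, T.ends ≠ [] := by
    intro T; induction T <;> simp_all [PlaneTree.ends]
  induction h : w.length using Nat.strong_induction_on generalizing w with
  | _ n ih =>
  subst h
  have : {T : PlaneTree L | T.ends = w} ⊆ (⋃ l ∈ {l | l ∈ w}, {PlaneTree.leaf l}) ∪
      ⋃ i ∈ Finset.Ioo 0 w.length,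
        Set.image2 PlaneTree.node {T | T.ends = w.take i} {T | T.ends = w.drop i} := by
    rintro (l | ⟨s, t⟩) h
    · left; simp [PlaneTree.ends] at h; simp [← h]
    · right
      have h' : s.ends ++ t.ends = w := h
      have h1 := List.length_pos_of_ne_nil (hne s)
      have h2 := List.length_pos_of_ne_nil (hne t)
      simp only [Set.mem_iUnion]
      refine ⟨s.ends.length, by simp [← h']; omega, s, by simp [← h'], t, by simp [← h'], rfl⟩
  refine (Set.Finite.subset ?_ this : Set.Finite _)
  refine Set.Finite.union
    (Set.Finite.biUnion (List.finite_toSet w) fun _ _ => Set.finite_singleton _) ?_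
  refine Set.Finite.biUnion (Finset.finite_toSet _) fun i hi => ?_
  simp at hi
  exact Set.Finite.image2 _ (ih _ (by simp; omega) _ rfl) (ih _ (by simp; omega) _ rfl)

/-- The internal vertices. -/
def PlaneTree.Vert : PlaneTree L → Type
  | .leaf _ => Empty
  | .node s t => Option (s.Vert ⊕ t.Vert)

instance PlaneTree.instFiniteVert : (t : PlaneTree L) → Finite t.Vert
  | .leaf _ => inferInstanceAs (Finite Empty)
  | .node s t =>
    have := PlaneTree.instFiniteVert s
    have := PlaneTree.instFiniteVert t
    inferInstanceAs (Finite (Option (s.Vert ⊕ t.Vert)))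

instance PlaneTree.instFintypeVert (t : PlaneTree L) : Fintype t.Vert := Fintype.ofFinite _

/-- The edges, given by their two end points; an end point is an internal vertex, or an external
vertex with its decoration. Here `i` names the internal vertices and `p` is the root. The edges are
listed in the order `E₁ ∧ E₂ ∧ …` of the canonical orientation of the plane tree: it is the one
which for a single vertex is the clockwise order of its three edges, and which for the union of two
trees along an edge `E` is `E ∧ A ∧ B`, if `E ∧ A` and `E ∧ B` are the canonical orientations of
the two trees. -/
def PlaneTree.edges {V : Type} : (t : PlaneTree L) → (i : t.Vert → V) → (p : V ⊕ L) →
    List ((V ⊕ L) × (V ⊕ L))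
  | .leaf l, _, p => [(p, .inr l)]
  | .node s t, i, p =>
    (p, .inl (i none)) ::
      (s.edges (fun v => i (some (.inl v))) (.inl (i none)) ++
        t.edges (fun v => i (some (.inr v))) (.inl (i none)))

end Trees

/-! ### Hodge correlators -/

section Correlators

variable {X : Type*} [TopologicalSpace X] [ChartedSpace ℂ X]

/-- The decorations: points of `S` and one-forms. -/
abbrev Letter (S : Finset X) : Type _ := S ⊕ OneForms X

/-- What an edge with given end points contributes: either a function on `X ^ V`, namely the Green
function of its end points; or, if one of its ends is decorated by a one-form (a special edge), this
one-form on the copy of `X` which corresponds to the other end point. A tree which consists of just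
one edge contributes `0` unless both its ends are decorated by points. -/
def edgeTerm {S : Finset X} (G : X → X → ℝ) {V : Type} :
    (V ⊕ Letter S) × (V ⊕ Letter S) → ((V → X) → ℝ) ⊕ (V × OneForms X)
  | (.inl u, .inl v) => .inl fun x => G (x u) (x v)
  | (.inl u, .inr (.inl s)) => .inl fun x => G (x u) s
  | (.inr (.inl s), .inl v) => .inl fun x => G s (x v)
  | (.inr (.inl s), .inr (.inl s')) => .inl fun _ => G s s'
  | (.inl u, .inr (.inr η)) => .inr (u, η)
  | (.inr (.inr η), .inl v) => .inr (v, η)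
  | (.inr (.inl _), .inr (.inr _)) => .inl fun _ => 0
  | (.inr (.inr _), .inr (.inl _)) => .inl fun _ => 0
  | (.inr (.inr _), .inr (.inr _)) => .inl fun _ => 0

/-- The one-form `η` on the `v`-th copy of `X`, pulled back to `X ^ V`, in the coordinates `c`. -/
def oneFormAt {V : Type} (c : V → Chart X) (z : V → ℂ) (v : V) (η : OneForms X) : Cov V where
  toFun w := η.1.1 (c v) (z v) * w v + η.2.1 (c v) (z v) * (starRingEnd ℂ) (w v)
  map_add' w w' := by simp; ring
  map_smul' r w := by simp; ring

/-- The number of pairs in which an element of the second kind precedes one of the first kind. -/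
def inversions {A B : Type*} : List (A ⊕ B) → ℕ
  | [] => 0
  | .inl _ :: l => inversions l
  | .inr _ :: l => (l.filterMap Sum.getLeft?).length + inversions l

/-- The form `sgn · ω_r(G_{E_0}, …, G_{E_r}) ∧ G_{E_{r+1}} ∧ …` on `X ^ V`, in the coordinates `c`.
The edges are given in an order which represents the canonical orientation of the tree; they are
reordered so that the special edges come last, and `sgn` is the sign of the reordering. -/
def kappa {V : Type} [Fintype V] (E : List (((V → X) → ℝ) ⊕ (V × OneForms X)))
    (c : V → Chart X) (z : V → ℂ) : ExtForm V :=
  (-1 : ℂ) ^ inversions E •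
    (omegaList z ((E.filterMap Sum.getLeft?).map fun F => localRep F c) *
      ((E.filterMap Sum.getRight?).map fun p =>
        ExteriorAlgebra.ι ℂ (oneFormAt c z p.1 p.2)).prod)

variable [CompactSpace X] [MeasurableSpace X] [BorelSpace X] {S : Finset X}

/-- The integral of `κ_T` over the product of copies of `X` corresponding to the internal vertices
of the plane trivalent tree `T` with root decorated by `l₀`. -/
def treeIntegral (G : X → X → ℝ) (l₀ : Letter S) (T : PlaneTree (Letter S)) : ℂ :=
  ∫ x : T.Vert → X,
    topCoeff (kappa ((T.edges id (.inr l₀)).map (edgeTerm G))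
      (fun v => chartSel X (x v)) (fun v => (chartSel X (x v)).1 (x v)))
    ∂(Measure.pi fun _ => chartMeasure X)

/-- The Hodge correlator of a cyclic word in points of `S` and one-forms: the sum of the tree
integrals over all plane trivalent trees whose ends are decorated, clockwise, by the letters of the
word, the first letter being placed at the root. The sum is finite. -/
def corWord (G : X → X → ℝ) : List (Letter S) → ℂ
  | [] => 0
  | l₀ :: w => ∑ᶠ T : {T : PlaneTree (Letter S) // T.ends = w}, treeIntegral G l₀ T.1

variable (S) in
/-- `V^∨ = ℂ[S] ⊕ (Ω¹ ⊕ Ω̄¹)`. -/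
abbrev VDual : Type _ := (S →₀ ℂ) × OneForms X

/-- The Hodge correlator map as a linear functional on the tensor algebra of `V^∨`: the linear
extension of `corWord` from words in points of `S` and one-forms of a basis `b` of `Ω¹ ⊕ Ω̄¹`. -/
def cor (G : X → X → ℝ) {K : Type*} (b : Module.Basis K ℂ (OneForms X)) :
    TensorAlgebra ℂ (VDual S) →ₗ[ℂ] ℂ :=
  ((Finsupp.basisSingleOne (ι := S) (R := ℂ)).prod b).tensorAlgebra.constr ℂ
    fun w : FreeMonoid (S ⊕ K) => corWord G ((FreeMonoid.toList w).map (Sum.map id b))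

end Correlators

/-! ### Shuffles and the cyclic envelope of the tensor algebra -/

section Cyclic

/-- The `(p, q)`-shuffles: the permutations `σ` of the indices such that in the sequence
`σ(1), …, σ(p+q)` the indices `1, …, p` appear in this order, and so do `p+1, …, p+q`. -/
def shuffles (p q : ℕ) : Finset (Equiv.Perm (Fin (p + q))) :=
  {σ | ∀ i j : Fin (p + q), i < j → ((j : ℕ) < p ∨ p ≤ (i : ℕ)) → σ.symm i < σ.symm j}

/-- The sequence `v₀, v_{σ(1)}, …, v_{σ(n)}`. -/
def permuteTail {W : Type*} {n : ℕ} (v : Fin (n + 1) → W) (σ : Equiv.Perm (Fin n)) :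
    Fin (n + 1) → W :=
  Fin.cons (v 0) fun i => v (σ i).succ

variable (W : Type*) [AddCommGroup W] [Module ℂ W]

/-- The augmentation ideal `T(W)⁺`. -/
def augIdeal : Submodule ℂ (TensorAlgebra ℂ W) :=
  LinearMap.ker (TensorAlgebra.algebraMapInv (R := ℂ) (M := W)).toLinearMap

/-- The subspace of `T(W)⁺` generated by commutators of elements of `T(W)⁺`. -/
def commutators : Submodule ℂ (augIdeal W) :=
  Submodule.span ℂ {c | ∃ x y : augIdeal W, (c : TensorAlgebra ℂ W) = x.1 * y.1 - y.1 * x.1}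

/-- The cyclic envelope `T(W)⁺ / [T(W)⁺, T(W)⁺]`. -/
abbrev CycEnv : Type _ := augIdeal W ⧸ commutators W

variable {W}

/-- The element `v₀ ⊗ … ⊗ v_n` of `T(W)⁺`. -/
def tensorWord {n : ℕ} (v : Fin (n + 1) → W) : augIdeal W :=
  ⟨(List.ofFn fun i => TensorAlgebra.ι ℂ (v i)).prod, by
    simp [augIdeal, List.ofFn_succ, TensorAlgebra.algebraMapInv]⟩

/-- The cyclic word `𝒞(v₀ ⊗ … ⊗ v_n)`. -/
def cycWord {n : ℕ} (v : Fin (n + 1) → W) : CycEnv W := (commutators W).mkQ (tensorWord v)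

variable (W)

/-- The subspace of shuffle relations in the cyclic envelope. -/
def shuffleRelations : Submodule ℂ (CycEnv W) :=
  Submodule.span ℂ {c | ∃ p q : ℕ, 1 ≤ p ∧ 1 ≤ q ∧ ∃ v : Fin (p + q + 1) → W,
    c = ∑ σ ∈ shuffles p q, cycWord (permuteTail v σ)}

/-- The quotient of the cyclic envelope by the shuffle relations. -/
abbrev CLie : Type _ := CycEnv W ⧸ shuffleRelations W

end Cyclic

end HodgeCorrelator

end

/-! Shuffle relations. With v₀ at the root, the shuffle sum runs over the plane trees whose other
ends carry v₁, …, v_p and v_{p+1}, …, v_{p+q}, each family in its own order; call the families two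
colours. In such a tree some vertex joins a subtree with ends of one colour only to a subtree with
ends of the other colour only. Exchanging these two subtrees keeps both coloured subwords, and a
fixed rule for choosing the vertex makes this an involution (`PlaneTree.flip`). A subtree together
with the edge leading to it has an odd number of edges, so the exchange reverses the canonical
orientation. The integrand is antisymmetric in the edges (`SignedPerm.kappa_eq`), and renaming
vertices only permutes copies of X, which have even real dimension (`edgeIntegral_reindex`). Hence
the terms cancel in pairs (`sum_shuffles_withEnds`). Neither a property of G nor convergence enters:
the integrals are only reindexed and multiplied by signs.

Cyclic invariance. Moving the root from one end to the next (`PlaneTree.rotate`) moves, at each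
vertex passed, one edge across an even number of edges, so no sign appears; but edges get reversed,
which requires G(x, y) = G(y, x). For x outside the support of a delta current, G(x, y) - G(y, x) is
harmonic in y: the logarithms cancel, and so do the Laplacians, both given by the density of μ. By
the maximum principle it is a constant C(x). Clearly C(x) = -C(y) for distinct points, and a third
point forces C = 0 (`IsGreenFunction.symm`).

Both properties hold for words in arbitrary letters; checking them on a basis gives them on the
tensor algebra, and the map descends to the two quotients. -/

noncomputable section

namespace HodgeCorrelator

/-! ### Permutations of lists with signs -/

/-- `SignedPerm ε l l'`: the list `l'` is obtained from `l` by a permutation of sign `ε`. -/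
inductive SignedPerm {A : Type*} : ℤˣ → List A → List A → Prop
  | nil : SignedPerm 1 [] []
  | cons (a : A) {ε : ℤˣ} {l l' : List A} (h : SignedPerm ε l l') :
      SignedPerm ε (a :: l) (a :: l')
  | swap (a b : A) (l : List A) : SignedPerm (-1) (a :: b :: l) (b :: a :: l)
  | trans {ε ε' : ℤˣ} {l l' l'' : List A} (h : SignedPerm ε l l') (h' : SignedPerm ε' l' l'') :
      SignedPerm (ε * ε') l l''

namespace SignedPerm

variable {A B : Type*} {ε ε' : ℤˣ} {l l' l'' : List A}

theorem refl (l : List A) : SignedPerm 1 l l := by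
  induction l with
  | nil => exact .nil
  | cons a l ih => exact ih.cons a

theorem of_eq (h : SignedPerm ε l l') (hε : ε = ε') : SignedPerm ε' l l' := hε ▸ h

theorem map (f : A → B) (h : SignedPerm ε l l') : SignedPerm ε (l.map f) (l'.map f) := by
  induction h with
  | nil => exact .nil
  | cons a _ ih => exact ih.cons _
  | swap a b l => exact .swap _ _ _
  | trans _ _ ih ih' => exact ih.trans ih'

theorem length_eq (h : SignedPerm ε l l') : l.length = l'.length := by
  induction h <;> simp_all

theorem append_left (r : List A) (h : SignedPerm ε l l') : SignedPerm ε (r ++ l) (r ++ l') := by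
  induction r with
  | nil => exact h
  | cons a r ih => exact ih.cons a

theorem append_right (r : List A) (h : SignedPerm ε l l') : SignedPerm ε (l ++ r) (l' ++ r) := by
  induction h with
  | nil => exact refl r
  | cons a _ ih => exact ih.cons a
  | swap a b l => exact .swap a b _
  | trans _ _ ih ih' => exact ih.trans ih'

theorem cons_append (a : A) (l r : List A) :
    SignedPerm ((-1) ^ l.length) (a :: (l ++ r)) (l ++ a :: r) := by
  induction l with
  | nil => exact refl _
  | cons b l ih =>
    exact ((SignedPerm.swap a b (l ++ r)).trans (ih.cons b)).of_eq (by simp [pow_succ])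

theorem append_comm (l l' : List A) :
    SignedPerm ((-1) ^ (l.length * l'.length)) (l ++ l') (l' ++ l) := by
  induction l with
  | nil => simpa using refl l'
  | cons a l ih =>
    exact ((ih.cons a).trans (cons_append a l' l)).of_eq (by simp [add_mul, pow_add])

/-- A signed permutation of lists comes from a permutation of the indices. -/
theorem exists_perm (h : SignedPerm ε l l') : ∃ (n : ℕ) (f : Fin n → A) (τ : Equiv.Perm (Fin n)),
    l = List.ofFn f ∧ l' = List.ofFn (f ∘ τ) ∧ Equiv.Perm.sign τ = ε := by
  induction h with
  | nil => exact ⟨0, Fin.elim0, 1, by simp⟩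
  | cons a _ ih =>
    obtain ⟨n, f, τ, rfl, rfl, rfl⟩ := ih
    -- `decomposeFin.symm (0, τ)` fixes 0 and acts as τ on the successors.
    refine ⟨n + 1, Fin.cons a f, Equiv.Perm.decomposeFin.symm (0, τ), by simp, ?_, by simp⟩
    simp [List.ofFn_succ, Function.comp_def]
  | swap a b l =>
    refine ⟨l.length + 2, Fin.cons a (Fin.cons b l.get), Equiv.swap 0 1, ?_, ?_, ?_⟩
    · simp
    · rw [List.ofFn_succ, List.ofFn_succ]
      have : ∀ i : Fin l.length, Equiv.swap (0 : Fin (l.length + 2)) 1 i.succ.succ = i.succ.succ :=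
        fun i => Equiv.swap_apply_of_ne_of_ne (Fin.succ_ne_zero _)
          (fun h => Fin.succ_ne_zero i (Fin.succ_injective _ h))
      simp [this]
    · exact Equiv.Perm.sign_swap (by simp)
  | trans _ _ ih ih' =>
    obtain ⟨n, f, τ, rfl, rfl, rfl⟩ := ih
    obtain ⟨n', f', τ', h, rfl, rfl⟩ := ih'
    obtain rfl : n = n' := by simpa using congrArg List.length h
    obtain rfl := List.ofFn_injective h
    exact ⟨n, f, τ * τ', rfl, rfl, by simp⟩

end SignedPerm

/-! ### Plane trees -/

namespace PlaneTree

variable {L M : Type*}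

/-- Change of the decorations. -/
def map (f : L → M) : PlaneTree L → PlaneTree M
  | .leaf l => .leaf (f l)
  | .node s t => .node (s.map f) (t.map f)

theorem ends_map (f : L → M) (T : PlaneTree L) : (T.map f).ends = T.ends.map f := by
  induction T <;> simp_all [PlaneTree.ends, map]

theorem eq_of_map_eq (f : L → M) (T T' : PlaneTree L) (h : T.map f = T'.map f)
    (he : T.ends = T'.ends) : T = T' := by
  induction T generalizing T' with
  | leaf l =>
    cases T' with
    | leaf l' => simpa [ends] using he
    | node s t => simp [map] at h
  | node s t ihs iht =>
    cases T' with
    | leaf l' => simp [map] at h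
    | node s' t' =>
      simp only [map, node.injEq] at h
      have hl : s.ends.length = s'.ends.length := by
        simpa [ends_map] using congrArg (fun T => T.ends.length) h.1
      obtain ⟨h1, h2⟩ := List.append_inj he hl
      rw [ihs s' h.1 h1, iht t' h.2 h2]

theorem exists_map_eq (f : L → M) (T : PlaneTree M) (w : List L) (h : T.ends = w.map f) :
    ∃ T' : PlaneTree L, T'.ends = w ∧ T'.map f = T := by
  induction T generalizing w with
  | leaf m =>
    match w, h with
    | [l], h => exact ⟨.leaf l, rfl, by simpa [ends, map] using h.symm⟩
  | node s t ihs iht =>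
    obtain ⟨w₁, w₂, rfl, h1, h2⟩ := List.map_eq_append_iff.1 h.symm
    obtain ⟨s', hs, rfl⟩ := ihs w₁ h1.symm
    obtain ⟨t', ht, rfl⟩ := iht w₂ h2.symm
    exact ⟨.node s' t', by simp [ends, hs, ht], rfl⟩

/-- The plane trees with given decorations of the ends. -/
def withEnds (w : List L) : Finset (PlaneTree L) :=
  (show {T : PlaneTree L | T.ends = w}.Finite from finite_ends_eq w).toFinset

theorem mem_withEnds {w : List L} {T : PlaneTree L} : T ∈ withEnds w ↔ T.ends = w := by
  simp [withEnds]

theorem finsum_ends_eq {R : Type*} [AddCommMonoid R] (F : PlaneTree L → R) (w : List L) :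
    ∑ᶠ T : {T : PlaneTree L // T.ends = w}, F T.1 = ∑ T ∈ withEnds w, F T := by
  rw [← finsum_mem_coe_finset, ← finsum_set_coe_eq_finsum_mem (withEnds w : Set (PlaneTree L))]
  have : (withEnds w : Set (PlaneTree L)) = {T | T.ends = w} := by
    ext; simp [mem_withEnds]
  rw [this]
  rfl

theorem sum_withEnds_map {R : Type*} [AddCommMonoid R] (f : L → M) (F : PlaneTree M → R)
    (w : List L) : ∑ T ∈ withEnds (w.map f), F T = ∑ T ∈ withEnds w, F (T.map f) := by
  symm
  refine Finset.sum_bij (fun T _ => T.map f) ?_ ?_ ?_ (fun _ _ => rfl)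
  · intro T hT
    rw [mem_withEnds] at *
    rw [ends_map, hT]
  · intro T hT T' hT' h
    rw [mem_withEnds] at hT hT'
    exact eq_of_map_eq f T T' h (hT.trans hT'.symm)
  · intro T hT
    obtain ⟨T', h, rfl⟩ := exists_map_eq f T w (mem_withEnds.1 hT)
    exact ⟨T', mem_withEnds.2 h, rfl⟩

/-- `T'` is obtained from `T` by exchanging the two subtrees at one vertex. -/
inductive SwapRel : PlaneTree L → PlaneTree L → Prop
  | swap (s t : PlaneTree L) : SwapRel (.node s t) (.node t s)
  | left {s s' : PlaneTree L} (t : PlaneTree L) (h : SwapRel s s') :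
      SwapRel (.node s t) (.node s' t)
  | right (s : PlaneTree L) {t t' : PlaneTree L} (h : SwapRel t t') :
      SwapRel (.node s t) (.node s t')

theorem SwapRel.map (f : L → M) {T T' : PlaneTree L} (h : SwapRel T T') :
    SwapRel (T.map f) (T'.map f) := by
  induction h with
  | swap s t => exact .swap _ _
  | left t _ ih => exact .left _ ih
  | right s _ ih => exact .right _ ih

/-! #### A sign reversing involution on trees with ends of two colours -/

section Mixed

variable (c : L → Bool)

/-- Ends of both colours occur. -/
def Mixed (T : PlaneTree L) : Prop := ∀ d, T.ends.filter (c · = d) ≠ []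

open Classical in
/-- Exchange of the subtrees at the first vertex at which a subtree with ends of one colour meets a
subtree with ends of the other colour. -/
def flip : PlaneTree L → PlaneTree L
  | .leaf l => .leaf l
  | .node s t =>
    if s.Mixed c then .node s.flip t else if t.Mixed c then .node s t.flip else .node t s

variable {c}

theorem not_mixed_leaf (l : L) : ¬ (leaf l).Mixed c := by
  intro h
  have := h (!(c l))
  simp [ends] at this

theorem Mixed.swapRel_flip {T : PlaneTree L} (h : T.Mixed c) : SwapRel T (T.flip c) := by
  induction T with
  | leaf l => exact absurd h (not_mixed_leaf l)
  | node s t ihs iht =>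
    rw [flip]
    split_ifs with hs ht
    · exact .left _ (ihs hs)
    · exact .right _ (iht ht)
    · exact .swap _ _

/-- Where the exchange takes place, one of the two subtrees has no end of colour d, so the order of
concatenation does not affect the subword of colour d. -/
theorem Mixed.filter_ends_flip {T : PlaneTree L} (h : T.Mixed c) (d : Bool) :
    (T.flip c).ends.filter (c · = d) = T.ends.filter (c · = d) := by
  induction T with
  | leaf l => exact absurd h (not_mixed_leaf l)
  | node s t ihs iht =>
    rw [flip]
    split_ifs with hs ht
    · simp only [ends, List.filter_append, ihs hs]
    · simp only [ends, List.filter_append, iht ht]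
    · simp only [Mixed, not_forall, not_not] at hs ht
      obtain ⟨ds, hs⟩ := hs
      obtain ⟨dt, ht⟩ := ht
      have hne : ds ≠ dt := by
        rintro rfl
        exact h ds (by simp only [ends, List.filter_append, hs, ht, List.append_nil])
      simp only [ends, List.filter_append]
      rcases Bool.eq_or_eq_not d ds with rfl | rfl
      · rw [hs]; simp
      · obtain rfl : dt = !ds := by cases ds <;> cases dt <;> simp_all
        rw [ht]; simp

theorem Mixed.flip {T : PlaneTree L} (h : T.Mixed c) : (T.flip c).Mixed c := by
  intro d
  rw [h.filter_ends_flip]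
  exact h d

/-- The second search makes the same choices as the first, because being mixed depends only on the
coloured subwords, which the exchange preserves. -/
theorem Mixed.flip_flip {T : PlaneTree L} (h : T.Mixed c) : (T.flip c).flip c = T := by
  induction T with
  | leaf l => rfl
  | node s t ihs iht =>
    rw [PlaneTree.flip]
    split_ifs with hs ht
    · rw [PlaneTree.flip, if_pos hs.flip, ihs hs]
    · rw [PlaneTree.flip, if_neg hs, if_pos ht.flip, iht ht]
    · rw [PlaneTree.flip, if_neg ht, if_neg hs]

end Mixed

end PlaneTree

/-! ### Shuffles -/

/-- A word is a shuffle iff its letters of either colour are in the right order. -/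
theorem exists_shuffle_iff (p q : ℕ) (w : List (Fin (p + q))) :
    (∃ σ ∈ shuffles p q, List.ofFn σ = w) ↔ ∀ d : Bool,
      w.filter (fun i : Fin (p + q) => decide ((i : ℕ) < p) = d) =
        (List.finRange (p + q)).filter (fun i : Fin (p + q) => decide ((i : ℕ) < p) = d) := by
  constructor
  · rintro ⟨σ, hσ, rfl⟩ d
    simp only [shuffles, Finset.mem_filter, Finset.mem_univ, true_and] at hσ
    have hperm : (List.ofFn σ).Perm (List.finRange (p + q)) := by
      have := Equiv.Perm.ofFn_comp_perm σ (id : Fin (p + q) → Fin (p + q))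
      simpa [List.ofFn_id] using this
    -- Both sides are strictly increasing arrangements of the same indices, hence equal.
    refine (hperm.filter _).eq_of_pairwise (le := (· < ·))
      (fun a b _ _ h h' => absurd h' h.not_gt) ?_ ?_
    · rw [List.pairwise_filter, List.pairwise_ofFn]
      intro i j hij hi hj
      by_contra hlt
      have hji : σ j < σ i := lt_of_le_of_ne (not_lt.1 hlt) (by simpa using hij.ne')
      have := hσ _ _ hji (by
        simp only [decide_eq_true_eq] at hi hj
        by_cases h : (σ i : ℕ) < p
        · exact .inl h
        · right
          rw [← hj] at hi
          simp [h] at hi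
          exact hi)
      simp at this
      exact absurd this hij.not_gt
    · exact (List.pairwise_lt_finRange _).filter _
  · intro h
    -- Every word is a rearrangement of its two colour classes placed one after the other.
    have hperm : w.Perm (List.finRange (p + q)) := by
      have key : ∀ u : List (Fin (p + q)),
          (u.filter (fun i : Fin (p + q) => decide ((i : ℕ) < p) = true) ++
            u.filter (fun i : Fin (p + q) => decide ((i : ℕ) < p) = false)).Perm u := by
        intro u
        have := List.filter_append_perm (fun i : Fin (p + q) => decide ((i : ℕ) < p)) u
        convert this using 3
        · simp
        · ext; simp [← decide_not]
      have h1 := key w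
      rw [h, h] at h1
      exact h1.symm.trans (key _)
    have hlen : w.length = p + q := by simpa using hperm.length_eq
    have hnd : w.Nodup := hperm.nodup_iff.2 (List.nodup_finRange _)
    obtain ⟨f, rfl⟩ : ∃ f : Fin (p + q) → Fin (p + q), w = List.ofFn f := by
      refine ⟨fun i => w.get (i.cast hlen.symm), ?_⟩
      apply List.ext_get <;> simp [hlen]
    have hinj : Function.Injective f := List.nodup_ofFn.1 hnd
    let σ := Equiv.ofBijective f (Finite.injective_iff_bijective.1 hinj)
    refine ⟨σ, ?_, rfl⟩
    simp only [shuffles, Finset.mem_filter, Finset.mem_univ, true_and]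
    intro i j hij hc
    -- The subword of the colour of `i`, which is also the colour of `j`, is increasing.
    have hp := (List.pairwise_lt_finRange (p + q)).filter
      (fun x : Fin (p + q) => decide (decide ((x : ℕ) < p) = decide ((i : ℕ) < p)))
    rw [← h, List.pairwise_filter, List.pairwise_ofFn] at hp
    by_contra hlt
    have hji : σ.symm j < σ.symm i := lt_of_le_of_ne (not_lt.1 hlt) (by simpa using hij.ne')
    have hσ : ∀ k, f (σ.symm k) = k := fun k => σ.apply_symm_apply k
    have := hp hji (by
      have : (i : ℕ) < j := hij
      simp only [hσ, decide_eq_true_eq, decide_eq_decide]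
      omega) (by simp [hσ])
    rw [hσ, hσ] at this
    exact absurd this hij.not_gt

/-- A function on plane trees which changes sign when two subtrees are exchanged at a vertex
satisfies the shuffle relations. -/
theorem sum_shuffles_withEnds {L : Type*} (F : PlaneTree L → ℂ)
    (hF : ∀ T T', PlaneTree.SwapRel T T' → F T' = -F T) {p q : ℕ} (hp : 1 ≤ p) (hq : 1 ≤ q)
    (l : Fin (p + q) → L) :
    ∑ σ ∈ shuffles p q, ∑ T ∈ PlaneTree.withEnds (List.ofFn (l ∘ σ)), F T = 0 := by
  classical
  let c : Fin (p + q) → Bool := fun i => decide ((i : ℕ) < p)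
  -- Decorating by indices instead of letters keeps the trees of different shuffles apart even when
  -- letters coincide.
  have h1 : ∀ σ : Equiv.Perm (Fin (p + q)), ∑ T ∈ PlaneTree.withEnds (List.ofFn (l ∘ σ)), F T =
      ∑ T ∈ PlaneTree.withEnds (List.ofFn σ), F (T.map l) := by
    intro σ
    rw [← PlaneTree.sum_withEnds_map, List.map_ofFn]
  simp_rw [h1]
  rw [← Finset.sum_biUnion]
  swap
  · intro σ _ τ _ hστ
    refine Finset.disjoint_left.2 fun T hT hT' => hστ ?_
    rw [PlaneTree.mem_withEnds] at hT hT'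
    exact DFunLike.coe_injective (List.ofFn_injective (hT.symm.trans hT'))
  set 𝒯 := (shuffles p q).biUnion fun σ => PlaneTree.withEnds (List.ofFn σ) with h𝒯
  have hmem : ∀ T, T ∈ 𝒯 ↔ ∀ d : Bool, T.ends.filter (c · = d) =
      (List.finRange (p + q)).filter (c · = d) := by
    intro T
    rw [← exists_shuffle_iff, h𝒯]
    simp only [Finset.mem_biUnion, PlaneTree.mem_withEnds]
    simp only [eq_comm]
  have hmix : ∀ T ∈ 𝒯, T.Mixed c := by
    intro T hT d hnil
    rw [(hmem T).1 hT] at hnil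
    rw [List.filter_eq_nil_iff] at hnil
    cases d
    · exact hnil ⟨p, by omega⟩ (List.mem_finRange _) (by simp [c])
    · exact hnil ⟨0, by omega⟩ (List.mem_finRange _) (by simp [c]; omega)
  have hneg : ∀ T ∈ 𝒯, F ((T.flip c).map l) = - F (T.map l) := fun T hT =>
    hF _ _ ((hmix T hT).swapRel_flip.map l)
  refine Finset.sum_involution (fun T _ => T.flip c) ?_ ?_ ?_ ?_
  · intro T hT
    rw [hneg T hT, add_neg_cancel]
  · intro T hT h0 heq
    have := hneg T hT
    rw [heq] at this
    -- A fixed tree would satisfy F = -F, so it would contribute nothing.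
    exact h0 (self_eq_neg.1 this)
  · intro T hT
    rw [hmem]
    intro d
    rw [(hmix T hT).filter_ends_flip, (hmem T).1 hT]
  · intro T hT
    exact (hmix T hT).flip_flip

/-! ### Antisymmetry of `ω_r` and of `κ` -/

section Antisymmetry

variable {V : Type*}

/-- Substitute σ ↦ τσ in the alternating sum; the shape of the alternated expression plays no role.
-/
theorem omegaForm_comp_perm {m : ℕ} (φ : Fin (m + 1) → (V → ℂ) → ℂ)
    (τ : Equiv.Perm (Fin (m + 1))) (z : V → ℂ) :
    omegaForm (φ ∘ τ) z = ((Equiv.Perm.sign τ : ℤ) : ℂ) • omegaForm φ z := by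
  unfold omegaForm
  rw [smul_comm]
  congr 1
  rw [Finset.smul_sum]
  refine Fintype.sum_equiv (Equiv.mulLeft τ) _ _ fun σ => ?_
  rw [smul_smul]
  congr 1
  simp only [Equiv.coe_mulLeft, map_mul, Units.val_mul, Int.cast_mul, ← mul_assoc]
  rw [← Int.cast_mul, ← Units.val_mul, Int.units_mul_self]
  simp

theorem omegaList_ofFn {m : ℕ} (φ : Fin (m + 1) → (V → ℂ) → ℂ) (z : V → ℂ) :
    omegaList z (List.ofFn φ) = omegaForm φ z := by
  have key : ∀ (n : ℕ) (l : List ((V → ℂ) → ℂ)) (h : l.length = n + 1),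
      omegaList z l = omegaForm (m := n) (fun i => l.get (i.cast h.symm)) z := by
    intro n l h
    match l, h with
    | f :: fs, h =>
      obtain rfl : fs.length = n := by simpa using h
      rfl
  rw [key m _ (by simp)]
  congr 1
  funext i
  rw [List.get_ofFn]
  rfl

theorem SignedPerm.omegaList_eq {ε : ℤˣ} {l l' : List ((V → ℂ) → ℂ)} (h : SignedPerm ε l l')
    (z : V → ℂ) : omegaList z l' = ((ε : ℤ) : ℂ) • omegaList z l := by
  obtain ⟨n, f, τ, rfl, rfl, rfl⟩ := h.exists_perm
  cases n with
  | zero => simp [omegaList]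
  | succ m => rw [omegaList_ofFn, omegaList_ofFn, omegaForm_comp_perm]

theorem SignedPerm.prod_ι_eq {M : Type*} [AddCommGroup M] [Module ℂ M] {ε : ℤˣ} {l l' : List M}
    (h : SignedPerm ε l l') : (l'.map (ExteriorAlgebra.ι ℂ)).prod =
      ((ε : ℤ) : ℂ) • (l.map (ExteriorAlgebra.ι ℂ)).prod := by
  induction h with
  | nil => simp
  | cons a _ ih => simp [ih]
  | swap a b l =>
    have := ExteriorAlgebra.ι_add_mul_swap (R := ℂ) b a
    simp only [List.map_cons, List.prod_cons, ← mul_assoc, eq_neg_of_add_eq_zero_left this]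
    simp
  | trans _ _ ih ih' =>
    rw [ih', ih, smul_smul]
    simp [mul_comm]

/-- A transposition of two entries of the same kind acts on one of the two sublists. A transposition
of entries of different kinds leaves both sublists alone and changes the number of inversions by
one. -/
theorem SignedPerm.exists_split {A B : Type*} {ε : ℤˣ} {l l' : List (A ⊕ B)}
    (h : SignedPerm ε l l') : ∃ ε₁ ε₂ : ℤˣ,
      SignedPerm ε₁ (l.filterMap Sum.getLeft?) (l'.filterMap Sum.getLeft?) ∧
      SignedPerm ε₂ (l.filterMap Sum.getRight?) (l'.filterMap Sum.getRight?) ∧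
      (-1) ^ inversions l' * (ε₁ * ε₂) = ε * (-1) ^ inversions l := by
  induction h with
  | nil => exact ⟨1, 1, .nil, .nil, rfl⟩
  | cons a _ ih =>
    obtain ⟨ε₁, ε₂, h₁, h₂, h⟩ := ih
    cases a with
    | inl a =>
      exact ⟨ε₁, ε₂, h₁.cons a, h₂, h⟩
    | inr b =>
      refine ⟨ε₁, ε₂, h₁, h₂.cons b, ?_⟩
      -- The new entry precedes equally many entries of the first kind in both lists.
      rw [inversions, inversions, pow_add, pow_add, mul_assoc, h, h₁.length_eq]
      ac_rfl
  | swap a b l =>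
    rcases a with a | a <;> rcases b with b | b
    · exact ⟨-1, 1, .swap a b _, .refl _, by simp [inversions]⟩
    · exact ⟨1, 1, .refl _, .refl _, by simp [inversions, pow_add, pow_succ]⟩
    · exact ⟨1, 1, .refl _, .refl _, by simp [inversions, pow_add, pow_succ]⟩
    · refine ⟨1, -1, .refl _, .swap a b _, ?_⟩
      change (-1) ^ inversions (.inr a :: .inr b :: l) * (1 * -1) = _
      rw [one_mul, mul_comm]
  | trans _ _ ih ih' =>
    obtain ⟨ε₁, ε₂, h₁, h₂, h⟩ := ih
    obtain ⟨δ₁, δ₂, h₁', h₂', h'⟩ := ih'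
    refine ⟨ε₁ * δ₁, ε₂ * δ₂, h₁.trans h₁', h₂.trans h₂', ?_⟩
    rw [show ε₁ * δ₁ * (ε₂ * δ₂) = δ₁ * δ₂ * (ε₁ * ε₂) by ac_rfl, ← mul_assoc, h', mul_assoc, h]
    ac_rfl

/-- The antisymmetry of ω_r in its functions and the anticommutation of one-forms combine with the
sign of moving the special edges to the end. -/
theorem SignedPerm.kappa_eq {X : Type*} [TopologicalSpace X] [ChartedSpace ℂ X]
    {V : Type} [Fintype V] {ε : ℤˣ} {E E' : List (((V → X) → ℝ) ⊕ (V × OneForms X))}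
    (h : SignedPerm ε E E') (c : V → Chart X) (z : V → ℂ) :
    kappa E' c z = ((ε : ℤ) : ℂ) • kappa E c z := by
  obtain ⟨ε₁, ε₂, h₁, h₂, h⟩ := h.exists_split
  have h₂' := (h₂.map fun p => oneFormAt c z p.1 p.2).prod_ι_eq
  simp only [List.map_map, Function.comp_def] at h₂'
  rw [kappa, kappa, (h₁.map fun F => localRep F c).omegaList_eq, h₂', smul_mul_smul_comm, smul_smul,
    smul_smul]
  congr 1
  have := congrArg (fun u : ℤˣ => ((u : ℤ) : ℂ)) h
  simpa using this

end Antisymmetry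

/-! ### Invariance under renaming of the internal vertices -/

section Reindex

variable {V W : Type*}

/-- The pullback of covectors along the isomorphism `ℂ ^ W ≃ ℂ ^ V` induced by `V ≃ W`. -/
def covReindex (φ : V ≃ W) : Cov V →ₗ[ℂ] Cov W where
  toFun θ := θ ∘ₗ LinearMap.funLeft ℝ ℂ φ
  map_add' _ _ := rfl
  map_smul' _ _ := rfl

/-- The pullback of forms along the isomorphism `ℂ ^ W ≃ ℂ ^ V` induced by `V ≃ W`. -/
def formReindex (φ : V ≃ W) : ExtForm V →ₐ[ℂ] ExtForm W := ExteriorAlgebra.map (covReindex φ)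

theorem formReindex_ι (φ : V ≃ W) (θ : Cov V) :
    formReindex φ (ExteriorAlgebra.ι ℂ θ) = ExteriorAlgebra.ι ℂ (covReindex φ θ) :=
  ExteriorAlgebra.map_apply_ι _ _

/-- The values of a covector on the frame given by an enumeration of `V`. -/
def evalFrameOf {V : Type*} {n : ℕ} (e : V ≃ Fin n) : Cov V →ₗ[ℂ] (Fin (n * 2) → ℂ) where
  toFun θ k := θ (open Classical in Pi.single (e.symm (finProdFinEquiv.symm k).1)
    (if (finProdFinEquiv.symm k).2 = 0 then 1 else Complex.I))
  map_add' _ _ := rfl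
  map_smul' _ _ := rfl

/-- The coefficient of the top degree part of a form with respect to the frame given by an
enumeration of `V`. -/
def topCoeffOf {V : Type*} {n : ℕ} (e : V ≃ Fin n) : ExtForm V →ₗ[ℂ] ℂ :=
  ExteriorAlgebra.liftAlternating
    (Pi.single (n * 2) (Matrix.detRowAlternating.compLinearMap (evalFrameOf e)))

theorem evalFrameOf_trans {n : ℕ} (e : V ≃ Fin n) (π : Equiv.Perm (Fin n)) (θ : Cov V) :
    evalFrameOf (e.trans π) θ = evalFrameOf e θ ∘
      (finProdFinEquiv.symm.trans
        ((Equiv.prodCongrLeft fun _ => π.symm).trans finProdFinEquiv)) := by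
  ext k
  simp only [evalFrameOf, LinearMap.coe_mk, AddHom.coe_mk, Function.comp_apply, Equiv.trans_apply,
    Equiv.symm_apply_apply]
  rfl

/-- A new enumeration permutes the pairs (e_v, i e_v) as blocks of length two, so the determinant
changes by the square of the sign of π. -/
theorem topCoeffOf_trans {n : ℕ} (e : V ≃ Fin n) (π : Equiv.Perm (Fin n)) :
    topCoeffOf (e.trans π) = topCoeffOf e := by
  unfold topCoeffOf
  congr 2
  ext θ
  simp only [AlternatingMap.compLinearMap_apply, Matrix.detRowAlternating]
  change Matrix.det (fun i => evalFrameOf (e.trans π) (θ i)) =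
    Matrix.det (fun i => evalFrameOf e (θ i))
  simp_rw [evalFrameOf_trans]
  have := Matrix.det_permute' (finProdFinEquiv.symm.trans
    ((Equiv.prodCongrLeft fun _ : Fin 2 => π.symm).trans finProdFinEquiv))
    (fun i => evalFrameOf e (θ i))
  refine Eq.trans this ?_
  have hs := Equiv.Perm.sign_symm_trans_trans (Equiv.prodCongrLeft fun _ : Fin 2 => π.symm)
    (finProdFinEquiv (m := n) (n := 2))
  rw [Equiv.Perm.sign_prodCongrLeft] at hs
  rw [← Equiv.trans_assoc, hs]
  simp

theorem topCoeffOf_eq {n m : ℕ} (e : V ≃ Fin n) (e' : V ≃ Fin m) :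
    topCoeffOf e = topCoeffOf e' := by
  obtain rfl : n = m := by simpa using Fintype.card_congr (e.symm.trans e')
  rw [← topCoeffOf_trans e (e.symm.trans e')]
  congr 1
  ext; simp

theorem topCoeffOf_formReindex (φ : V ≃ W) {n : ℕ} (e : W ≃ Fin n) (η : ExtForm V) :
    topCoeffOf e (formReindex φ η) = topCoeffOf (φ.trans e) η := by
  suffices h : topCoeffOf e ∘ₗ (formReindex φ).toLinearMap = topCoeffOf (φ.trans e) from
    LinearMap.congr_fun h η
  apply ExteriorAlgebra.lhom_ext
  intro k
  ext θ
  simp only [LinearMap.compAlternatingMap_apply, LinearMap.comp_apply, AlgHom.toLinearMap_apply,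
    formReindex, ExteriorAlgebra.map_apply_ιMulti, topCoeffOf,
    ExteriorAlgebra.liftAlternating_apply_ιMulti]
  by_cases hk : k = n * 2
  · subst hk
    simp only [Pi.single_eq_same, AlternatingMap.compLinearMap_apply]
    congr 1
    ext i j
    simp only [evalFrameOf, covReindex, LinearMap.coe_mk, AddHom.coe_mk, Function.comp_apply,
      LinearMap.comp_apply]
    congr 1
    ext v
    classical
    simp [LinearMap.funLeft, Pi.single_apply, Equiv.eq_symm_apply]
  · simp [Pi.single_eq_of_ne hk]

variable [Fintype V] [Fintype W]

/-- The chain rule for an invertible linear substitution needs no differentiability of f, so it also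
applies at the singularities of G. -/
theorem fderiv_comp_reindex (φ : V ≃ W) (f : (V → ℂ) → ℂ) (z : W → ℂ) :
    (fderiv ℝ (fun y : W → ℂ => f (y ∘ φ)) z).toLinearMap =
      (fderiv ℝ f (z ∘ φ)).toLinearMap ∘ₗ LinearMap.funLeft ℝ ℂ φ := by
  have := (LinearEquiv.funCongrLeft ℝ ℂ φ).toContinuousLinearEquiv.comp_right_fderiv
    (f := f) (x := z)
  have h := congrArg ContinuousLinearMap.toLinearMap this
  exact h

theorem del_comp_reindex (φ : V ≃ W) (f : (V → ℂ) → ℂ) (z : W → ℂ) :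
    del (fun y : W → ℂ => f (y ∘ φ)) z = covReindex φ (del f (z ∘ φ)) := by
  rw [del, fderiv_comp_reindex]
  rfl

theorem delbar_comp_reindex (φ : V ≃ W) (f : (V → ℂ) → ℂ) (z : W → ℂ) :
    delbar (fun y : W → ℂ => f (y ∘ φ)) z = covReindex φ (delbar f (z ∘ φ)) := by
  rw [delbar, fderiv_comp_reindex]
  rfl

theorem omegaForm_comp_reindex (φ : V ≃ W) {m : ℕ} (f : Fin (m + 1) → (V → ℂ) → ℂ) (z : W → ℂ) :
    omegaForm (fun i (y : W → ℂ) => f i (y ∘ φ)) z = formReindex φ (omegaForm f (z ∘ φ)) := by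
  simp only [omegaForm, map_smul, map_sum, map_list_prod, List.map_ofFn, Function.comp_def,
    formReindex_ι]
  simp only [apply_ite (covReindex φ)]
  simp only [← Function.comp_def z φ, ← del_comp_reindex, ← delbar_comp_reindex]
  rfl

theorem omegaList_comp_reindex (φ : V ≃ W) (l : List ((V → ℂ) → ℂ)) (z : W → ℂ) :
    omegaList z (l.map fun f (y : W → ℂ) => f (y ∘ φ)) = formReindex φ (omegaList (z ∘ φ) l) := by
  obtain ⟨n, f, rfl⟩ : ∃ (n : ℕ) (f : Fin n → (V → ℂ) → ℂ), l = List.ofFn f :=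
    ⟨_, l.get, by simp⟩
  cases n with
  | zero => simp [omegaList]
  | succ m =>
    rw [List.map_ofFn, omegaList_ofFn, omegaList_ofFn, ← omegaForm_comp_reindex]
    rfl

theorem topCoeff_eq_topCoeffOf : topCoeff (V := V) = topCoeffOf (Fintype.equivFin V) := rfl

theorem topCoeff_formReindex (φ : V ≃ W) (η : ExtForm V) :
    topCoeff (formReindex φ η) = topCoeff η := by
  rw [topCoeff_eq_topCoeffOf, topCoeff_eq_topCoeffOf, topCoeffOf_formReindex]
  exact LinearMap.congr_fun (topCoeffOf_eq _ _) η

end Reindex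

/-! ### Renaming the vertices in κ -/

section

variable {X : Type*} [TopologicalSpace X] [ChartedSpace ℂ X] {V W : Type}

/-- Renaming of the vertices in the contribution of an edge. -/
def termReindex (φ : V ≃ W) :
    ((V → X) → ℝ) ⊕ (V × OneForms X) → ((W → X) → ℝ) ⊕ (W × OneForms X) :=
  Sum.map (fun F y => F (y ∘ φ)) (Prod.map φ id)

theorem edgeTerm_reindex {S : Finset X} (G : X → X → ℝ) (φ : V ≃ W)
    (E : (V ⊕ Letter S) × (V ⊕ Letter S)) :
    edgeTerm G (Prod.map (Sum.map φ id) (Sum.map φ id) E) = termReindex φ (edgeTerm G E) := by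
  rcases E with ⟨u | s | η, v | s' | η'⟩ <;> rfl

theorem inversions_map {A B A' B' : Type*} (f : A → A') (g : B → B') (l : List (A ⊕ B)) :
    inversions (l.map (Sum.map f g)) = inversions l := by
  induction l with
  | nil => rfl
  | cons a l ih =>
    cases a with
    | inl a => simpa [inversions] using ih
    | inr b =>
      have : ∀ l : List (A ⊕ B), ((l.map (Sum.map f g)).filterMap Sum.getLeft?).length =
          (l.filterMap Sum.getLeft?).length := by
        intro l
        induction l with
        | nil => rfl
        | cons a l ih =>
          cases a with
          | inl a => exact congrArg Nat.succ ih
          | inr b => exact ih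
      simp only [List.map_cons, Sum.map_inr, inversions, ih, this]

theorem filterMap_getLeft_map {A B A' B' : Type*} (f : A → A') (g : B → B') (l : List (A ⊕ B)) :
    (l.map (Sum.map f g)).filterMap Sum.getLeft? = (l.filterMap Sum.getLeft?).map f := by
  induction l with
  | nil => rfl
  | cons a l ih =>
    cases a with
    | inl a => exact congrArg (f a :: ·) ih
    | inr b => exact ih

theorem filterMap_getRight_map {A B A' B' : Type*} (f : A → A') (g : B → B') (l : List (A ⊕ B)) :
    (l.map (Sum.map f g)).filterMap Sum.getRight? = (l.filterMap Sum.getRight?).map g := by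
  induction l with
  | nil => rfl
  | cons a l ih =>
    cases a with
    | inl a => exact ih
    | inr b => exact congrArg (g b :: ·) ih

theorem kappa_reindex [Fintype V] [Fintype W] (φ : V ≃ W)
    (E : List (((V → X) → ℝ) ⊕ (V × OneForms X))) (c : W → Chart X) (z : W → ℂ) :
    kappa (E.map (termReindex φ)) c z = formReindex φ (kappa E (c ∘ φ) (z ∘ φ)) := by
  unfold kappa termReindex
  rw [inversions_map, filterMap_getLeft_map, filterMap_getRight_map, map_smul, map_mul,
    map_list_prod, ← omegaList_comp_reindex]
  simp only [List.map_map, Function.comp_def, formReindex_ι]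
  rfl

end

/-! ### Integrals attached to lists of edges -/

namespace PlaneTree

variable {L : Type*}

/-- The vertex at the end of the root edge. -/
def top {V : Type} : (T : PlaneTree L) → (T.Vert → V) → V ⊕ L
  | .leaf l, _ => .inr l
  | .node _ _, i => .inl (i none)

/-- The edges other than the root edge. -/
def body {V : Type} : (T : PlaneTree L) → (T.Vert → V) → List ((V ⊕ L) × (V ⊕ L))
  | .leaf _, _ => []
  | .node s t, i =>
    s.edges (fun v => i (some (.inl v))) (.inl (i none)) ++
      t.edges (fun v => i (some (.inr v))) (.inl (i none))

theorem edges_eq {V : Type} (T : PlaneTree L) (i : T.Vert → V) (p : V ⊕ L) :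
    T.edges i p = (p, T.top i) :: T.body i := by
  cases T <;> rfl

/-- This parity governs all orientation signs: two branches at a vertex anticommute as blocks of
edges, while together they commute with any edge. -/
theorem odd_length_edges {V : Type} (T : PlaneTree L) (i : T.Vert → V) (p : V ⊕ L) :
    Odd (T.edges i p).length := by
  induction T generalizing p with
  | leaf l => exact odd_one
  | node s t ihs iht =>
    simp only [edges, List.length_cons, List.length_append]
    exact ((ihs _ _).add_odd (iht _ _)).add_one

theorem edges_map {V W : Type} (φ : V → W) (T : PlaneTree L) (i : T.Vert → V) (p : V ⊕ L) :
    (T.edges i p).map (Prod.map (Sum.map φ id) (Sum.map φ id)) =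
      T.edges (φ ∘ i) (Sum.map φ id p) := by
  induction T generalizing p with
  | leaf l => rfl
  | node s t ihs iht =>
    simp only [edges, List.map_cons, List.map_append, ihs, iht]
    rfl

theorem top_map {V W : Type} (φ : V → W) (T : PlaneTree L) (i : T.Vert → V) :
    Sum.map φ id (T.top i) = T.top (φ ∘ i) := by
  cases T <;> rfl

theorem body_map {V W : Type} (φ : V → W) (T : PlaneTree L) (i : T.Vert → V) :
    (T.body i).map (Prod.map (Sum.map φ id) (Sum.map φ id)) = T.body (φ ∘ i) := by
  cases T with
  | leaf l => rfl
  | node s t =>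
    simp only [body, List.map_append, edges_map]
    rfl

/-- Exchanging the two subtrees at a vertex changes the orientation. -/
theorem SwapRel.exists_equiv {T T' : PlaneTree L} (h : SwapRel T T') :
    ∃ φ : T'.Vert ≃ T.Vert, ∀ {V : Type} (i : T.Vert → V) (p : V ⊕ L),
      SignedPerm (-1) (T.edges i p) (T'.edges (i ∘ φ) p) := by
  induction h with
  | swap s t =>
    refine ⟨Equiv.optionCongr (Equiv.sumComm t.Vert s.Vert), fun i p => ?_⟩
    refine SignedPerm.cons _ ((SignedPerm.append_comm _ _).of_eq ?_)
    exact ((odd_length_edges _ _ _).mul (odd_length_edges _ _ _)).neg_one_pow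
  | @left s s' t _ ih =>
    obtain ⟨φ, hφ⟩ := ih
    refine ⟨Equiv.optionCongr (Equiv.sumCongr φ (Equiv.refl t.Vert)), fun i p => ?_⟩
    exact SignedPerm.cons _ ((hφ _ _).append_right _)
  | @right s t t' _ ih =>
    obtain ⟨φ, hφ⟩ := ih
    refine ⟨Equiv.optionCongr (Equiv.sumCongr (Equiv.refl s.Vert) φ), fun i p => ?_⟩
    exact SignedPerm.cons _ ((hφ _ _).append_left _)

/-- The edges of the union of two trees along their root edges. -/
def glue {V : Type} (T R : PlaneTree L) (i : T.Vert → V) (j : R.Vert → V) :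
    List ((V ⊕ L) × (V ⊕ L)) :=
  (R.top j, T.top i) :: (T.body i ++ R.body j)

theorem glue_map {V W : Type} (φ : V → W) (T R : PlaneTree L) (i : T.Vert → V) (j : R.Vert → V) :
    (T.glue R i j).map (Prod.map (Sum.map φ id) (Sum.map φ id)) = T.glue R (φ ∘ i) (φ ∘ j) := by
  simp [glue, body_map, top_map]

/-- Rerooting: the leftmost end of `T` becomes the root of the union of `T` and `R`. -/
def rotate : PlaneTree L → PlaneTree L → L × PlaneTree L
  | .leaf l, R => (l, R)
  | .node s t, R => s.rotate (.node t R)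

/-- Rerooting: the rightmost end of `R` becomes the root of the union of `T` and `R`. -/
def rotateBack (T : PlaneTree L) : PlaneTree L → L × PlaneTree L
  | .leaf l => (l, T)
  | .node t R => rotateBack (.node T t) R

theorem rotate_ends (T R : PlaneTree L) :
    (T.rotate R).1 :: (T.rotate R).2.ends = T.ends ++ R.ends := by
  induction T generalizing R with
  | leaf l => rfl
  | node s t ihs _ => rw [rotate, ihs]; simp [ends]

theorem rotateBack_ends (T R : PlaneTree L) :
    (T.rotateBack R).2.ends ++ [(T.rotateBack R).1] = T.ends ++ R.ends := by
  induction R generalizing T with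
  | leaf l => rfl
  | node t R _ ih => rw [rotateBack, ih]; simp [ends]

theorem rotateBack_rotate (T R : PlaneTree L) :
    (leaf (T.rotate R).1).rotateBack (T.rotate R).2 = T.rotateBack R := by
  induction T generalizing R with
  | leaf l => rfl
  | node s t ihs _ => rw [rotate, ihs, rotateBack]

theorem rotate_rotateBack (T R : PlaneTree L) :
    (T.rotateBack R).2.rotate (leaf (T.rotateBack R).1) = T.rotate R := by
  induction R generalizing T with
  | leaf l => rfl
  | node t R _ ih => rw [rotateBack, ih, rotate]

/-- `rotate` and `rotateBack`, applied with a single leaf on the other side, are mutually inverse;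
the root label is recovered from the word of ends. -/
theorem sum_withEnds_rotate {A : Type*} [AddCommMonoid A] (F : L → PlaneTree L → A)
    (hF : ∀ l T, F (T.rotate (leaf l)).1 (T.rotate (leaf l)).2 = F l T) (l l' : L) (w : List L) :
    ∑ T ∈ withEnds (l' :: w), F l T = ∑ T ∈ withEnds (w ++ [l]), F l' T := by
  refine Finset.sum_bij' (fun T _ => (T.rotate (leaf l)).2)
    (fun T _ => ((leaf l').rotateBack T).2) ?_ ?_ ?_ ?_ ?_
  · intro T hT
    rw [mem_withEnds] at *
    have := T.rotate_ends (leaf l)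
    rw [hT, List.cons_append] at this
    exact (List.cons.inj this).2
  · intro T hT
    rw [mem_withEnds] at *
    have := (leaf l').rotateBack_ends T
    rw [hT, ← List.append_assoc] at this
    exact (List.append_inj' this rfl).1
  · intro T hT
    rw [mem_withEnds] at hT
    have h1 : (T.rotate (leaf l)).1 = l' := by
      have := T.rotate_ends (leaf l)
      rw [hT, List.cons_append] at this
      exact (List.cons.inj this).1
    have h := T.rotateBack_rotate (leaf l)
    rw [h1] at h
    exact congrArg Prod.snd h
  · intro T hT
    rw [mem_withEnds] at hT
    have h1 : ((leaf l').rotateBack T).1 = l := by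
      have := (leaf l').rotateBack_ends T
      rw [hT, ← List.append_assoc] at this
      exact List.singleton_inj.1 (List.append_inj' this rfl).2
    have h := (leaf l').rotate_rotateBack T
    rw [h1] at h
    exact congrArg Prod.snd h
  · intro T hT
    rw [mem_withEnds] at hT
    have h1 : (T.rotate (leaf l)).1 = l' := by
      have := T.rotate_ends (leaf l)
      rw [hT, List.cons_append] at this
      exact (List.cons.inj this).1
    rw [← hF, h1]

end PlaneTree

theorem edgeTerm_symm {X : Type*} [TopologicalSpace X] [ChartedSpace ℂ X] {S : Finset X}
    {G : X → X → ℝ} (hG : ∀ x y, G x y = G y x) {V : Type} (a b : V ⊕ Letter S) :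
    edgeTerm G (a, b) = edgeTerm G (b, a) := by
  rcases a with u | s | η <;> rcases b with v | s' | η' <;> simp [edgeTerm, hG]

section EdgeIntegral

variable {X : Type*} [TopologicalSpace X] [ChartedSpace ℂ X]
  [CompactSpace X] [MeasurableSpace X] [BorelSpace X]

/-- Product measures can be reindexed once the factors are σ-finite. The preimages of balls under a
chart exhaust its domain and have finite measure. -/
instance sigmaFinite_chartMeasure : SigmaFinite (chartMeasure X) := by
  unfold chartMeasure
  have key : ∀ e : Chart X, SigmaFinite (((volume : Measure ℂ).restrict
      (e.1.target ∩ e.1.symm ⁻¹' (chartSel X ⁻¹' {e}))).map e.1.symm) := by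
    intro e
    set A := e.1.target ∩ e.1.symm ⁻¹' (chartSel X ⁻¹' {e})
    by_cases hm : AEMeasurable e.1.symm ((volume : Measure ℂ).restrict A)
    swap
    -- The image under a map that is not a.e. measurable is zero by convention.
    · rw [Measure.map_of_not_aemeasurable hm]; infer_instance
    let U : ℕ → Set X := fun n => e.1.source ∩ e.1 ⁻¹' Metric.ball 0 n
    have hU : ∀ n, IsOpen (U n) := fun n => e.1.isOpen_inter_preimage Metric.isOpen_ball
    -- The complement of the chart domain is added to cover X; it carries no mass.
    refine ⟨⟨⟨fun n => U n ∪ e.1.sourceᶜ, fun _ => trivial, fun n => ?_, ?_⟩⟩⟩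
    · rw [Measure.map_apply_of_aemeasurable hm
        ((hU n).measurableSet.union e.1.open_source.measurableSet.compl)]
      refine lt_of_le_of_lt ?_ (measure_ball_lt_top (μ := (volume : Measure ℂ)) (x := 0) (r := n))
      refine (Measure.restrict_mono Set.inter_subset_left le_rfl _).trans ?_
      rw [Measure.restrict_apply' e.1.open_target.measurableSet]
      refine measure_mono ?_
      rintro z ⟨hz, hzA⟩
      rcases hz with hz | hz
      · simpa [e.1.right_inv hzA] using hz.2
      · exact absurd (e.1.map_target hzA) hz
    · refine Set.eq_univ_of_forall fun x => ?_
      by_cases hx : x ∈ e.1.source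
      · obtain ⟨n, hn⟩ := exists_nat_gt ‖e.1 x‖
        exact Set.mem_iUnion.2 ⟨n, .inl ⟨hx, by simpa using hn⟩⟩
      · exact Set.mem_iUnion.2 ⟨0, .inr hx⟩
  induction (exists_chartSel X).choose_spec.2.1.toFinset using Finset.cons_induction with
  | empty => rw [Finset.sum_empty]; infer_instance
  | cons e s he ih => rw [Finset.sum_cons]; have := key e; infer_instance

variable {S : Finset X} (G : X → X → ℝ)

/-- The integral over `X ^ V` of the form attached to a list of edges. -/
def edgeIntegral {V : Type} [Fintype V] (E : List ((V ⊕ Letter S) × (V ⊕ Letter S))) : ℂ :=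
  ∫ x : V → X, topCoeff (kappa (E.map (edgeTerm G))
    (fun v => chartSel X (x v)) (fun v => (chartSel X (x v)).1 (x v)))
    ∂(Measure.pi fun _ => chartMeasure X)

theorem treeIntegral_eq_edgeIntegral (l : Letter S) (T : PlaneTree (Letter S)) :
    treeIntegral G l T = edgeIntegral G (T.edges id (.inr l)) := rfl

theorem edgeIntegral_reindex {V W : Type} [Fintype V] [Fintype W] (φ : V ≃ W)
    (E : List ((V ⊕ Letter S) × (V ⊕ Letter S))) :
    edgeIntegral G (E.map (Prod.map (Sum.map φ id) (Sum.map φ id))) = edgeIntegral G E := by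
  have hmp := (measurePreserving_piCongrLeft (fun _ : W => chartMeasure X) φ).symm
  have h := hmp.integral_comp' (fun x : V → X => topCoeff (kappa (E.map (edgeTerm G))
    (fun v => chartSel X (x v)) (fun v => (chartSel X (x v)).1 (x v))))
  unfold edgeIntegral
  rw [← h]
  congr 1
  funext x
  rw [List.map_map, show edgeTerm G ∘ Prod.map (Sum.map φ id) (Sum.map φ id) =
    termReindex φ ∘ edgeTerm (S := S) G from funext (edgeTerm_reindex G φ), ← List.map_map,
    kappa_reindex, topCoeff_formReindex]
  rfl

theorem SignedPerm.edgeIntegral_eq {V : Type} [Fintype V] {ε : ℤˣ}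
    {E E' : List ((V ⊕ Letter S) × (V ⊕ Letter S))} (h : SignedPerm ε E E') :
    edgeIntegral G E' = ((ε : ℤ) : ℂ) * edgeIntegral G E := by
  unfold edgeIntegral
  rw [← integral_const_mul]
  congr 1
  funext x
  rw [(h.map (edgeTerm G)).kappa_eq, map_smul, smul_eq_mul]

/-- After a renaming of vertices the two trees have the same edges, listed in orders that differ by
an odd permutation. -/
theorem PlaneTree.SwapRel.treeIntegral_eq (l : Letter S) {T T' : PlaneTree (Letter S)}
    (h : SwapRel T T') : treeIntegral G l T' = -treeIntegral G l T := by
  obtain ⟨φ, hφ⟩ := h.exists_equiv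
  rw [treeIntegral_eq_edgeIntegral, treeIntegral_eq_edgeIntegral, ← edgeIntegral_reindex G φ,
    edges_map]
  have := (hφ id (.inr l)).edgeIntegral_eq G
  simpa using this

/-- The tree integral of the union of two trees along their root edges. -/
def glueIntegral (T R : PlaneTree (Letter S)) : ℂ :=
  edgeIntegral G (V := T.Vert ⊕ R.Vert) (T.glue R Sum.inl Sum.inr)

theorem edgeIntegral_glue {V : Type} [Fintype V] (T R : PlaneTree (Letter S))
    (φ : T.Vert ⊕ R.Vert ≃ V) :
    edgeIntegral G (T.glue R (φ ∘ Sum.inl) (φ ∘ Sum.inr)) = glueIntegral G T R := by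
  rw [glueIntegral, ← edgeIntegral_reindex G φ, PlaneTree.glue_map]

theorem glueIntegral_leaf_right (T : PlaneTree (Letter S)) (l : Letter S) :
    glueIntegral G T (.leaf l) = treeIntegral G l T := by
  rw [← edgeIntegral_glue G T (.leaf l) (Equiv.sumEmpty T.Vert Empty : T.Vert ⊕ Empty ≃ T.Vert),
    treeIntegral_eq_edgeIntegral, PlaneTree.edges_eq, PlaneTree.glue]
  simp only [PlaneTree.body, List.append_nil]
  rfl

variable {G}

theorem edgeIntegral_cons_symm (hG : ∀ x y, G x y = G y x)
    {V : Type} [Fintype V] (a b : V ⊕ Letter S)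
    (E : List ((V ⊕ Letter S) × (V ⊕ Letter S))) :
    edgeIntegral G ((a, b) :: E) = edgeIntegral G ((b, a) :: E) := by
  simp only [edgeIntegral, List.map_cons, edgeTerm_symm hG a b]

theorem glueIntegral_leaf_left (hG : ∀ x y, G x y = G y x)
    (l : Letter S) (R : PlaneTree (Letter S)) :
    glueIntegral G (.leaf l) R = treeIntegral G l R := by
  rw [← edgeIntegral_glue G (.leaf l) R (Equiv.emptySum Empty R.Vert : Empty ⊕ R.Vert ≃ R.Vert),
    treeIntegral_eq_edgeIntegral, PlaneTree.edges_eq, PlaneTree.glue, edgeIntegral_cons_symm hG]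
  simp only [PlaneTree.body, List.nil_append]
  rfl

/-- The bijection which moves the root edge past a vertex. -/
def optionSumAssoc (A B C : Type) : Option (A ⊕ B) ⊕ C ≃ A ⊕ Option (B ⊕ C) where
  toFun
    | .inl none => .inr none
    | .inl (some (.inl a)) => .inl a
    | .inl (some (.inr b)) => .inr (some (.inl b))
    | .inr c => .inr (some (.inr c))
  invFun
    | .inl a => .inl (some (.inl a))
    | .inr none => .inl none
    | .inr (some (.inl b)) => .inl (some (.inr b))
    | .inr (some (.inr c)) => .inr c
  left_inv := by rintro ((_ | a | b) | c) <;> rfl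
  right_inv := by rintro (a | _ | b | c) <;> rfl

/-- The edge towards R is reversed and moved across the edges of s and t, an even number in total;
the root edge of s then comes first. -/
theorem edgeIntegral_move_root (hG : ∀ x y, G x y = G y x) (s t R : PlaneTree (Letter S))
    {V : Type} [Fintype V] (i : s.Vert → V) (j : t.Vert → V) (k : R.Vert → V) (v : V) :
    edgeIntegral G ((R.top k, .inl v) :: (s.edges i (.inl v) ++ t.edges j (.inl v) ++ R.body k)) =
      edgeIntegral G ((.inl v, s.top i) ::
        (s.body i ++ (t.edges j (.inl v) ++ R.edges k (.inl v)))) := by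
  have heven := (s.odd_length_edges i (.inl v)).add_odd (t.odd_length_edges j (.inl v))
  rw [← List.length_append] at heven
  have h := ((SignedPerm.cons_append (.inl v, R.top k) (s.edges i (.inl v) ++ t.edges j (.inl v))
    (R.body k)).of_eq heven.neg_one_pow).edgeIntegral_eq G
  rw [Units.val_one, Int.cast_one, one_mul, edgeIntegral_cons_symm hG, ← R.edges_eq,
    List.append_assoc] at h
  rw [← h, s.edges_eq, List.cons_append]

/-- Both sides describe one tree, with branches s, t, R around a vertex, cut along the edge to R and
along the edge to s. -/
theorem glueIntegral_node (hG : ∀ x y, G x y = G y x) (s t R : PlaneTree (Letter S)) :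
    glueIntegral G (.node s t) R = glueIntegral G s (.node t R) := by
  let φ : (PlaneTree.node s t).Vert ⊕ R.Vert ≃ s.Vert ⊕ (PlaneTree.node t R).Vert :=
    optionSumAssoc s.Vert t.Vert R.Vert
  have h := edgeIntegral_move_root hG s t R (V := s.Vert ⊕ (PlaneTree.node t R).Vert)
    Sum.inl (fun v => .inr (some (.inl v))) (fun v => .inr (some (.inr v))) (.inr none)
  have h1 : (PlaneTree.node s t).glue R (φ ∘ Sum.inl) (φ ∘ Sum.inr) =
      (R.top fun v => .inr (some (.inr v)), .inl (.inr none)) ::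
        (s.edges Sum.inl (.inl (.inr none)) ++
          t.edges (fun v => .inr (some (.inl v))) (.inl (.inr none)) ++
          R.body fun v => .inr (some (.inr v))) := rfl
  have h2 : (.inl (.inr none), s.top Sum.inl) ::
      (s.body Sum.inl ++ (t.edges (fun v => .inr (some (.inl v))) (.inl (.inr none)) ++
        R.edges (fun v => .inr (some (.inr v))) (.inl (.inr none)))) =
      s.glue (V := s.Vert ⊕ (PlaneTree.node t R).Vert) (.node t R) Sum.inl Sum.inr := rfl
  exact (edgeIntegral_glue G (.node s t) R φ).symm.trans
    ((congrArg (edgeIntegral G) h1).trans (h.trans (congrArg (edgeIntegral G) h2)))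

theorem treeIntegral_rotate (hG : ∀ x y, G x y = G y x)
    (l : Letter S) (T : PlaneTree (Letter S)) :
    treeIntegral G (T.rotate (.leaf l)).1 (T.rotate (.leaf l)).2 = treeIntegral G l T := by
  -- The cut travels down the leftmost path of T until it reaches an end.
  have key : ∀ T R : PlaneTree (Letter S),
      treeIntegral G (T.rotate R).1 (T.rotate R).2 = glueIntegral G T R := by
    intro T
    induction T with
    | leaf l => exact fun R => (glueIntegral_leaf_left hG l R).symm
    | node s t ihs _ =>
      intro R
      rw [PlaneTree.rotate, ihs, glueIntegral_node hG]
  rw [key, glueIntegral_leaf_right]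

end EdgeIntegral

/-! ### Symmetry of the Green function -/

section GreenSymmetry

open Filter Topology InnerProductSpace Laplacian

/-- The maximum principle for harmonic functions. -/
theorem eventually_eq_of_harmonicAt_of_isLocalMax {u : ℂ → ℝ} {w : ℂ} (hu : HarmonicAt u w)
    (hmax : IsLocalMax u w) : ∀ᶠ z in 𝓝 w, u z = u w := by
  obtain ⟨R, hR, hball⟩ := Metric.eventually_nhds_iff_ball.1 hu.eventually
  obtain ⟨F, hF, hFu⟩ := HarmonicOnNhd.exists_analyticOnNhd_ball_re_eq (f := u) (z := w) (R := R)
    hball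
  have hw : w ∈ Metric.ball w R := Metric.mem_ball_self hR
  have hnhds : ∀ᶠ z in 𝓝 w, (F z).re = u z :=
    (Metric.isOpen_ball.eventually_mem hw).mono fun z hz => hFu hz
  rcases (hF w hw).eventually_constant_or_nhds_le_map_nhds with h | h
  · filter_upwards [h, hnhds] with z hz hz'
    rw [← hz', hz]
    exact hFu hw
  -- F is open at w, but near F w there are points F w + t, t > 0, of larger real part.
  · exfalso
    have h1 : ∀ᶠ ζ in 𝓝 (F w), ζ.re ≤ (F w).re := by
      have : ∀ᶠ z in 𝓝 w, (F z).re ≤ (F w).re := by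
        filter_upwards [hnhds, hmax] with z hz hz'
        rw [hz, show (F w).re = u w from hFu hw]
        exact hz'
      exact h this
    have ht : Tendsto (fun t : ℝ => F w + t) (𝓝[>] 0) (𝓝 (F w)) := by
      have : Tendsto (fun t : ℝ => F w + t) (𝓝 0) (𝓝 (F w + (0 : ℝ))) :=
        (continuous_const.add Complex.continuous_ofReal).tendsto 0
      simpa using this.mono_left nhdsWithin_le_nhds
    obtain ⟨t, ht1, ht2⟩ := ((ht.eventually h1).and self_mem_nhdsWithin).exists
    simp only [Complex.add_re, Complex.ofReal_re, add_le_iff_nonpos_right] at ht1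
    exact absurd ht1 (not_le.2 ht2)

/-- A function on a connected compact Riemann surface which is harmonic in the charts is
constant. -/
theorem eq_of_forall_harmonicAt {X : Type*} [TopologicalSpace X] [CompactSpace X]
    [ConnectedSpace X] [ChartedSpace ℂ X] {u : X → ℝ}
    (hu : ∀ y₀ : X, ∃ H : ℂ → ℝ, HarmonicAt H (chartAt ℂ y₀ y₀) ∧
      ∀ᶠ y in 𝓝 y₀, u y = H (chartAt ℂ y₀ y)) (y y' : X) : u y = u y' := by
  have hc : Continuous u := by
    refine continuous_iff_continuousAt.2 fun y₀ => ?_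
    obtain ⟨H, hH, hE⟩ := hu y₀
    exact (ContinuousAt.comp (g := H) hH.1.continuousAt
      ((chartAt ℂ y₀).continuousAt (mem_chart_source ℂ y₀))).congr
        (hE.mono fun _ h => h.symm)
  obtain ⟨m, -, hm⟩ := isCompact_univ.exists_isMaxOn Set.univ_nonempty hc.continuousOn
  -- The set where u attains its maximum is closed by continuity and open by the local maximum
  -- principle.
  have hclopen : IsClopen {y | u y = u m} := by
    refine ⟨isClosed_eq hc continuous_const, isOpen_iff_mem_nhds.2 fun y₀ hy₀ => ?_⟩
    obtain ⟨H, hH, hE⟩ := hu y₀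
    have hsrc := mem_chart_source ℂ y₀
    have h0 : u y₀ = H (chartAt ℂ y₀ y₀) := hE.self_of_nhds
    have hmax : IsLocalMax H (chartAt ℂ y₀ y₀) := by
      have hE' := ((chartAt ℂ y₀).tendsto_symm hsrc).eventually hE
      filter_upwards [hE', (chartAt ℂ y₀).eventually_right_inverse' hsrc] with w hw hw'
      rw [hw'] at hw
      rw [← hw, ← h0, show u y₀ = u m from hy₀]
      exact hm (Set.mem_univ _)
    have hconst := eventually_eq_of_harmonicAt_of_isLocalMax hH hmax
    filter_upwards [hE, ((chartAt ℂ y₀).continuousAt hsrc).eventually hconst] with y hy hy'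
    rw [hy, hy', ← h0]
    exact hy₀
  have := hclopen.eq_univ ⟨m, rfl⟩
  exact ((Set.ext_iff.1 this y).2 trivial : u y = u m).trans
    ((Set.ext_iff.1 this y').2 trivial : u y' = u m).symm

/-- `∂²/∂z_j∂z̄_j` is a quarter of the Laplacian in the `j`-th variable. -/
theorem dzbar_dz_eq_laplacian (j : Fin 2) {f : (Fin 2 → ℂ) → ℂ} {z : Fin 2 → ℂ}
    (hf : ContDiffAt ℝ 2 f z) :
    dzbar j (dz j f) z = 1 / 4 * Δ (fun w => f (Function.update z j w)) (z j) := by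
  set g : (Fin 2 → ℂ) → ((Fin 2 → ℂ) →L[ℝ] ℂ) := fderiv ℝ f with hg
  have hgd : HasFDerivAt g (fderiv ℝ g z) z :=
    ((hf.fderiv_right (m := 1) (by norm_num)).differentiableAt (by norm_num)).hasFDerivAt
  have hsym : ∀ v w, fderiv ℝ g z v w = fderiv ℝ g z w v := fun v w =>
    (hf.isSymmSndFDerivAt (by simp)).eq v w
  have hI : mulI (Pi.single j 1 : Fin 2 → ℂ) = Pi.single j Complex.I := by
    ext k
    simp [mulI, Pi.single_apply]
  have hdz : dz j f = fun z' => (1 / 2 : ℂ) * (g z' (Pi.single j 1) -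
      Complex.I * g z' (Pi.single j Complex.I)) := by
    funext z'
    simp [dz, del, hI, hg]
  have hD : ∀ v, fderiv ℝ (dz j f) z v = (1 / 2 : ℂ) * (fderiv ℝ g z v (Pi.single j 1) -
      Complex.I * fderiv ℝ g z v (Pi.single j Complex.I)) := by
    intro v
    have h1 : ∀ e : Fin 2 → ℂ, HasFDerivAt (fun z' => g z' e) ((fderiv ℝ g z).flip e) z := by
      intro e
      simpa using hgd.clm_apply (hasFDerivAt_const e z)
    have h2 := ((h1 (Pi.single j 1)).sub ((h1 (Pi.single j Complex.I)).const_mul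
      Complex.I)).const_mul (1 / 2 : ℂ)
    rw [hdz]
    refine (congrArg (· v) (HasFDerivAt.fderiv h2)).trans ?_
    simp
  have hL : dzbar j (dz j f) z = 1 / 4 * (fderiv ℝ g z (Pi.single j 1) (Pi.single j 1) +
      fderiv ℝ g z (Pi.single j Complex.I) (Pi.single j Complex.I)) := by
    have : dzbar j (dz j f) z = (1 / 2 : ℂ) * (fderiv ℝ (dz j f) z (Pi.single j 1) +
        Complex.I * fderiv ℝ (dz j f) z (Pi.single j Complex.I)) := by
      simp [dzbar, delbar, hI, mul_add]
    -- The mixed derivatives cancel by symmetry of the second derivative.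
    rw [this, hD, hD, hsym (Pi.single j Complex.I) (Pi.single j 1)]
    linear_combination (-1 / 4 : ℂ) *
      fderiv ℝ g z (Pi.single j Complex.I) (Pi.single j Complex.I) * Complex.I_mul_I
  rw [hL]
  congr 1
  have hupd : ∀ w, HasFDerivAt (Function.update z j)
      (ContinuousLinearMap.single ℝ (fun _ : Fin 2 => ℂ) j) w := fun w => by
    have heq : ContinuousLinearMap.single ℝ (fun _ : Fin 2 => ℂ) j =
        ContinuousLinearMap.pi (Pi.single j (ContinuousLinearMap.id ℝ ℂ)) := by
      refine ContinuousLinearMap.ext fun v => funext fun k => ?_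
      rcases eq_or_ne k j with rfl | h <;> simp [*]
    rw [heq]
    exact hasFDerivAt_update (𝕜 := ℝ) z w (i := j)
  have hev : ∀ᶠ w in 𝓝 (z j), fderiv ℝ (fun w => f (Function.update z j w)) w =
      (g (Function.update z j w)).comp (ContinuousLinearMap.single ℝ (fun _ : Fin 2 => ℂ) j) := by
    have hc : Tendsto (Function.update z j) (𝓝 (z j)) (𝓝 z) := by
      simpa using (hupd (z j)).continuousAt.tendsto
    filter_upwards [hc.eventually (hf.eventually (by simp))] with w hw
    exact ((hw.differentiableAt (by norm_num)).hasFDerivAt.comp w (hupd w)).fderiv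
  have h2 : ∀ a b : ℂ, iteratedFDeriv ℝ 2 (fun w => f (Function.update z j w)) (z j) ![a, b] =
      fderiv ℝ g z (Pi.single j a) (Pi.single j b) := by
    intro a b
    rw [iteratedFDeriv_two_apply]
    simp only [Matrix.cons_val_zero, Matrix.cons_val_one]
    rw [Filter.EventuallyEq.fderiv_eq hev]
    have hgd' : HasFDerivAt g (fderiv ℝ g z) (Function.update z j (z j)) := by simpa using hgd
    have h3 := (hgd'.comp (z j) (hupd (z j))).clm_comp
      (hasFDerivAt_const (ContinuousLinearMap.single ℝ (fun _ : Fin 2 => ℂ) j) (z j))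
    have h4 := HasFDerivAt.fderiv h3
    simp only [Function.comp_def] at h4
    rw [h4]
    simp
  rw [laplacian_eq_iteratedFDeriv_complexPlane]
  simp only [h2]

/-- A chart would map an isolated point to an open point of ℂ. -/
theorem neBot_nhdsNE {X : Type*} [TopologicalSpace X] [ChartedSpace ℂ X] (x : X) :
    (𝓝[≠] x).NeBot := by
  rw [neBot_iff, Ne, ← isOpen_singleton_iff_punctured_nhds]
  intro h
  have := (chartAt ℂ x).isOpen_image_of_subset_source h (by simp)
  rw [Set.image_singleton] at this
  exact not_isOpen_singleton _ this

/-! ### Green functions: smoothness, harmonicity and symmetry -/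

section Green

variable {X : Type*} [TopologicalSpace X] [ChartedSpace ℂ X]
  [CompactSpace X] [MeasurableSpace X] [BorelSpace X]

theorem AdmissibleCurrent.swap_mem_divisor {μ : AdmissibleCurrent X} {x y : X}
    (h : (x, y) ∈ μ.divisor) : (y, x) ∈ μ.divisor := by
  cases μ with
  | vol m => exact Eq.symm h
  | delta a =>
    rcases h with h | h | h
    · exact .inl h.symm
    · exact .inr (.inr h)
    · exact .inr (.inl h)

theorem AdmissibleCurrent.isClosed_divisor [T2Space X] (μ : AdmissibleCurrent X) :
    IsClosed μ.divisor := by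
  cases μ with
  | vol m => exact isClosed_diagonal
  | delta a =>
    exact isClosed_diagonal.union ((isClosed_eq continuous_fst continuous_const).union
      (isClosed_eq continuous_snd continuous_const))

/-- The logarithmic singularity is symmetric. -/
theorem AdmissibleCurrent.logSing_symm (μ : AdmissibleCurrent X) (x₀ y₀ x y : X) :
    μ.logSing x₀ y₀ x y = μ.logSing y₀ x₀ y x := by
  classical
  have h : (if x₀ = y₀ then Real.log (‖chartAt ℂ x₀ x - chartAt ℂ x₀ y‖ ^ 2) else 0) =
      if y₀ = x₀ then Real.log (‖chartAt ℂ y₀ y - chartAt ℂ y₀ x‖ ^ 2) else 0 := by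
    rcases eq_or_ne x₀ y₀ with rfl | h
    · simp [norm_sub_rev]
    · simp [h, h.symm]
  unfold logSing
  cases μ with
  | vol m => simpa using h
  | delta a =>
    simp only
    rw [add_comm (if y₀ = a then _ else _)]
    congr 1

/-- The Green function is smooth outside of the divisor. -/
theorem IsGreenFunction.eventually_contDiffAt [T2Space X] {μ : AdmissibleCurrent X} {g : ℕ}
    {α : Fin g → holForms X} {G : X → X → ℝ} (hG : IsGreenFunction μ α G) (x₀ y₀ : X) :
    ∀ᶠ p in 𝓝 (x₀, y₀), p ∉ μ.divisor →
      ContDiffAt ℝ 2 (fun z : Fin 2 → ℂ =>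
          (G ((chartAt ℂ x₀).symm (z 0)) ((chartAt ℂ y₀).symm (z 1)) : ℂ))
        ![chartAt ℂ x₀ p.1, chartAt ℂ y₀ p.2] := by
  classical
  obtain ⟨h, hh, hE⟩ := hG.local_form x₀ y₀
  have hsx := mem_chart_source ℂ x₀
  have hsy := mem_chart_source ℂ y₀
  have hcont : Tendsto (fun p : X × X => (chartAt ℂ x₀ p.1, chartAt ℂ y₀ p.2)) (𝓝 (x₀, y₀))
      (𝓝 (chartAt ℂ x₀ x₀, chartAt ℂ y₀ y₀)) := by
    rw [nhds_prod_eq, nhds_prod_eq]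
    exact ((chartAt ℂ x₀).continuousAt hsx).tendsto.prodMap
      ((chartAt ℂ y₀).continuousAt hsy).tendsto
  have hh2 : ContDiffAt ℝ 2 h (chartAt ℂ x₀ x₀, chartAt ℂ y₀ y₀) := by
    exact_mod_cast contDiffAt_infty.1 hh 2
  have e1 : ∀ᶠ p : X × X in 𝓝 (x₀, y₀), p.1 ∈ (chartAt ℂ x₀).source :=
    continuous_fst.continuousAt.eventually ((chartAt ℂ x₀).open_source.eventually_mem hsx)
  have e2 : ∀ᶠ p : X × X in 𝓝 (x₀, y₀), p.2 ∈ (chartAt ℂ y₀).source :=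
    continuous_snd.continuousAt.eventually ((chartAt ℂ y₀).open_source.eventually_mem hsy)
  filter_upwards [hE.eventually_nhds, hcont.eventually (hh2.eventually (by simp)), e1, e2]
    with p hp hhp hp1 hp2 hpd
  set z : Fin 2 → ℂ := ![chartAt ℂ x₀ p.1, chartAt ℂ y₀ p.2] with hz
  have ht0 : Tendsto (fun z' : Fin 2 → ℂ => (chartAt ℂ x₀).symm (z' 0)) (𝓝 z) (𝓝 p.1) :=
    ((chartAt ℂ x₀).tendsto_symm hp1).comp ((continuous_apply 0).tendsto z)
  have ht1 : Tendsto (fun z' : Fin 2 → ℂ => (chartAt ℂ y₀).symm (z' 1)) (𝓝 z) (𝓝 p.2) :=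
    ((chartAt ℂ y₀).tendsto_symm hp2).comp ((continuous_apply 1).tendsto z)
  have ht := ht0.prodMk_nhds ht1
  have hr0 : ∀ᶠ z' : Fin 2 → ℂ in 𝓝 z, chartAt ℂ x₀ ((chartAt ℂ x₀).symm (z' 0)) = z' 0 :=
    ((continuous_apply 0).tendsto z).eventually ((chartAt ℂ x₀).eventually_right_inverse' hp1)
  have hr1 : ∀ᶠ z' : Fin 2 → ℂ in 𝓝 z, chartAt ℂ y₀ ((chartAt ℂ y₀).symm (z' 1)) = z' 1 :=
    ((continuous_apply 1).tendsto z).eventually ((chartAt ℂ y₀).eventually_right_inverse' hp2)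
  have hc0 : ContDiffAt ℝ 2 (fun z' : Fin 2 → ℂ => z' 0) z := (contDiff_apply ℝ ℂ 0).contDiffAt
  have hc1 : ContDiffAt ℝ 2 (fun z' : Fin 2 → ℂ => z' 1) z := (contDiff_apply ℝ ℂ 1).contDiffAt
  have hlog : ∀ {k : (Fin 2 → ℂ) → ℂ}, ContDiffAt ℝ 2 k z → k z ≠ 0 →
      ContDiffAt ℝ 2 (fun z' => Real.log (‖k z'‖ ^ 2)) z := fun hk hne =>
    (hk.norm_sq ℝ).log (by simpa using hne)
  -- `K` is the logarithmic singularity in coordinates. Since charts are injective, the argument of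
  -- each logarithm vanishes only on the divisor.
  let K : (Fin 2 → ℂ) → ℝ := fun z' =>
    (if x₀ = y₀ then Real.log (‖z' 0 - z' 1‖ ^ 2) else 0) -
    match μ with
    | .vol _ => 0
    | .delta a =>
      (if x₀ = a then Real.log (‖z' 0 - chartAt ℂ a a‖ ^ 2) else 0) +
      (if y₀ = a then Real.log (‖z' 1 - chartAt ℂ a a‖ ^ 2) else 0)
  have hK : ContDiffAt ℝ 2 K z := by
    refine ContDiffAt.sub ?_ ?_
    · split_ifs with hxy
      · subst hxy
        refine hlog (hc0.sub hc1) (sub_ne_zero.2 fun heq => hpd ?_)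
        have : p.1 = p.2 := (chartAt ℂ x₀).injOn hp1 hp2 (by simpa [hz] using heq)
        cases μ with
        | vol m => exact this
        | delta a => exact .inl this
      · exact contDiffAt_const
    · cases μ with
      | vol m => exact contDiffAt_const
      | delta a =>
        refine ContDiffAt.add ?_ ?_
        · split_ifs with hxa
          · subst hxa
            refine hlog (hc0.sub contDiffAt_const) (sub_ne_zero.2 fun heq => hpd ?_)
            exact .inr (.inl ((chartAt ℂ x₀).injOn hp1 hsx (by simpa [hz] using heq)))
          · exact contDiffAt_const
        · split_ifs with hya
          · subst hya
            refine hlog (hc1.sub contDiffAt_const) (sub_ne_zero.2 fun heq => hpd ?_)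
            exact .inr (.inr ((chartAt ℂ y₀).injOn hp2 hsy (by simpa [hz] using heq)))
          · exact contDiffAt_const
  have hhc : ContDiffAt ℝ 2 (fun z' : Fin 2 → ℂ => h (z' 0, z' 1)) z :=
    ContDiffAt.comp (g := h) z (by simpa [hz] using hhp) (hc0.prodMk hc1)
  refine (Complex.ofRealCLM.contDiff.contDiffAt.comp z (hK.add hhc)).congr_of_eventuallyEq ?_
  filter_upwards [ht.eventually hp,
    ht.eventually (μ.isClosed_divisor.isOpen_compl.eventually_mem hpd),
    hr0, hr1] with z' h1 h2 h3 h4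
  simp only [Function.comp_apply, Complex.ofRealCLM_apply]
  rw [h1 h2]
  simp only [h3, h4]
  congr 2
  simp only [AdmissibleCurrent.logSing, K]
  congr 1
  · split_ifs with hxy
    · subst hxy
      rw [h3, h4]
    · rfl
  · cases μ with
    | vol m => rfl
    | delta a =>
      simp only
      congr 1
      · split_ifs with hxa
        · subst hxa
          rw [h3]
        · rfl
      · split_ifs with hya
        · subst hya
          rw [h4]
        · rfl

/-- A real function one of whose slices has a complexification in two variables. -/
theorem laplacian_slice_of_dzbar_dz {j : Fin 2} {f : (Fin 2 → ℂ) → ℂ} {z : Fin 2 → ℂ} {u : ℂ → ℝ}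
    {r : ℝ} (hf : ContDiffAt ℝ 2 f z) (hu : ∀ w, f (Function.update z j w) = u w)
    (hr : dzbar j (dz j f) z = -Real.pi * r) :
    ContDiffAt ℝ 2 u (z j) ∧ Δ u (z j) = -4 * Real.pi * r := by
  have hslice : ContDiffAt ℝ 2 (fun w => f (Function.update z j w)) (z j) :=
    ContDiffAt.comp (g := f) (z j) (by simpa using hf) (contDiff_update 2 z j).contDiffAt
  have hu' : u = Complex.reCLM ∘ fun w => f (Function.update z j w) := by
    funext w
    simp [hu]
  have hc : ContDiffAt ℝ 2 u (z j) := by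
    rw [hu']
    exact Complex.reCLM.contDiff.contDiffAt.comp (z j) hslice
  refine ⟨hc, ?_⟩
  have h := hc.laplacian_CLM_comp_left (l := Complex.ofRealCLM)
  rw [dzbar_dz_eq_laplacian j hf, show (fun w => f (Function.update z j w)) =
    Complex.ofRealCLM ∘ u from funext hu, h] at hr
  simp only [Function.comp_apply, Complex.ofRealCLM_apply] at hr
  have : ((Δ u (z j) : ℝ) : ℂ) = ((-4 * Real.pi * r : ℝ) : ℂ) := by
    push_cast
    linear_combination 4 * hr
  exact_mod_cast this

variable [T2Space X] {μ : AdmissibleCurrent X} {g : ℕ} {α : Fin g → holForms X} {G : X → X → ℝ}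

/-- The right hand side is the same for both slices of G, so it disappears from the difference G(x,
y) - G(y, x). -/
theorem IsGreenFunction.eventually_laplacian_right (hG : IsGreenFunction μ α G) (x y₀ : X) :
    ∀ᶠ y in 𝓝 y₀, (x, y) ∉ μ.divisor →
      ContDiffAt ℝ 2 (fun w => G x ((chartAt ℂ y₀).symm w)) (chartAt ℂ y₀ y) ∧
      Δ (fun w => G x ((chartAt ℂ y₀).symm w)) (chartAt ℂ y₀ y) =
        -4 * Real.pi * μ.dens ⟨chartAt ℂ y₀, chart_mem_atlas ℂ y₀⟩ (chartAt ℂ y₀ y) := by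
  have ht : Tendsto (fun y => (x, y)) (𝓝 y₀) (𝓝 (x, y₀)) := by
    exact (Continuous.prodMk_right x).tendsto y₀
  filter_upwards [ht.eventually (hG.eventually_contDiffAt x y₀),
    (chartAt ℂ y₀).open_source.eventually_mem (mem_chart_source ℂ y₀)] with y hy hys hd
  have hx := mem_chart_source ℂ x
  have heq := (hG.equation ![⟨chartAt ℂ x, chart_mem_atlas ℂ x⟩,
      ⟨chartAt ℂ y₀, chart_mem_atlas ℂ y₀⟩]
    ![chartAt ℂ x x, chartAt ℂ y₀ y]
    (by simp [Fin.forall_fin_two, (chartAt ℂ y₀).map_source hys])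
    (by simpa [(chartAt ℂ y₀).left_inv hys] using hd)).2.1
  exact laplacian_slice_of_dzbar_dz (j := 1) (hy hd)
    (fun w => by simp [(chartAt ℂ x).left_inv hx]) heq

theorem IsGreenFunction.eventually_laplacian_left (hG : IsGreenFunction μ α G) (x y₀ : X) :
    ∀ᶠ y in 𝓝 y₀, (y, x) ∉ μ.divisor →
      ContDiffAt ℝ 2 (fun w => G ((chartAt ℂ y₀).symm w) x) (chartAt ℂ y₀ y) ∧
      Δ (fun w => G ((chartAt ℂ y₀).symm w) x) (chartAt ℂ y₀ y) =
        -4 * Real.pi * μ.dens ⟨chartAt ℂ y₀, chart_mem_atlas ℂ y₀⟩ (chartAt ℂ y₀ y) := by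
  have ht : Tendsto (fun y => (y, x)) (𝓝 y₀) (𝓝 (y₀, x)) := by
    exact (Continuous.prodMk_left x).tendsto y₀
  filter_upwards [ht.eventually (hG.eventually_contDiffAt y₀ x),
    (chartAt ℂ y₀).open_source.eventually_mem (mem_chart_source ℂ y₀)] with y hy hys hd
  have hx := mem_chart_source ℂ x
  have heq := (hG.equation ![⟨chartAt ℂ y₀, chart_mem_atlas ℂ y₀⟩,
      ⟨chartAt ℂ x, chart_mem_atlas ℂ x⟩]
    ![chartAt ℂ y₀ y, chartAt ℂ x x]
    (by simp [Fin.forall_fin_two, (chartAt ℂ y₀).map_source hys])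
    (by simpa [(chartAt ℂ y₀).left_inv hys] using hd)).1
  exact laplacian_slice_of_dzbar_dz (j := 0) (hy hd)
    (fun w => by simp [(chartAt ℂ x).left_inv hx]) heq

/-- The antisymmetric part of the Green function extends to a harmonic function. -/
theorem IsGreenFunction.exists_harmonicAt (hG : IsGreenFunction μ α G) {x : X}
    (hx : ∀ y₀, ∀ᶠ y in 𝓝[≠] y₀, (x, y) ∉ μ.divisor) (y₀ : X) :
    ∃ H : ℂ → ℝ, HarmonicAt H (chartAt ℂ y₀ y₀) ∧
      ∀ᶠ y in 𝓝 y₀, (x, y) ∉ μ.divisor → G x y - G y x = H (chartAt ℂ y₀ y) := by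
  obtain ⟨h, hh, hE⟩ := hG.local_form x y₀
  obtain ⟨h', hh', hE'⟩ := hG.local_form y₀ x
  have hs := mem_chart_source ℂ y₀
  have ht : Tendsto (fun y => (x, y)) (𝓝 y₀) (𝓝 (x, y₀)) := by
    exact (Continuous.prodMk_right x).tendsto y₀
  have ht' : Tendsto (fun y => (y, x)) (𝓝 y₀) (𝓝 (y₀, x)) := by
    exact (Continuous.prodMk_left x).tendsto y₀
  set c := chartAt ℂ y₀ with hc
  -- The symmetric logarithmic parts cancel; the smooth remainders also define the difference on the
  -- divisor.
  let H : ℂ → ℝ := (fun w => h (chartAt ℂ x x, w)) - fun w => h' (w, chartAt ℂ x x)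
  have hH : ContDiffAt ℝ 2 H (c y₀) := by
    have h2 : ContDiffAt ℝ 2 h (chartAt ℂ x x, c y₀) := by exact_mod_cast contDiffAt_infty.1 hh 2
    have h2' : ContDiffAt ℝ 2 h' (c y₀, chartAt ℂ x x) := by
      exact_mod_cast contDiffAt_infty.1 hh' 2
    exact (ContDiffAt.comp (g := h) (c y₀) h2 (contDiffAt_const.prodMk contDiffAt_id)).sub
      (ContDiffAt.comp (g := h') (c y₀) h2' (contDiffAt_id.prodMk contDiffAt_const))
  have hD : ∀ᶠ y in 𝓝 y₀, (x, y) ∉ μ.divisor → G x y - G y x = H (c y) := by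
    filter_upwards [ht.eventually hE, ht'.eventually hE'] with y hy hy' hd
    rw [hy hd, hy' fun h => hd (AdmissibleCurrent.swap_mem_divisor h), μ.logSing_symm]
    simp [H]
  refine ⟨H, ⟨hH, ?_⟩, hD⟩
  have hΔ : ∀ᶠ y in 𝓝 y₀, (x, y) ∉ μ.divisor → Δ H (c y) = 0 := by
    filter_upwards [hD.eventually_nhds, hG.eventually_laplacian_right x y₀,
      hG.eventually_laplacian_left x y₀, c.open_source.eventually_mem hs] with y hy h1 h2 hys hd
    obtain ⟨hr, hr'⟩ := h1 hd
    obtain ⟨hl, hl'⟩ := h2 fun h => hd (AdmissibleCurrent.swap_mem_divisor h)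
    have hd' : ∀ᶠ y' in 𝓝 y, (x, y') ∉ μ.divisor :=
      (Continuous.prodMk_right x).continuousAt.eventually
        (μ.isClosed_divisor.isOpen_compl.eventually_mem hd)
    have heq : H =ᶠ[𝓝 (c y)] (fun w => G x (c.symm w)) - fun w => G (c.symm w) x := by
      filter_upwards [(c.tendsto_symm hys).eventually (hy.and hd'),
        c.eventually_right_inverse' hys] with w hw hw'
      have := hw.1 hw.2
      rw [hw'] at this
      exact this.symm
    rw [(laplacian_congr_nhds heq).self_of_nhds, hr.laplacian_sub hl, hr', hl', sub_self]
  have hpunct : ∀ᶠ w in 𝓝[≠] (c y₀), Δ H w = 0 := by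
    have h1 : ∀ᶠ y in 𝓝[≠] y₀, Δ H (c y) = 0 := by
      filter_upwards [hΔ.filter_mono nhdsWithin_le_nhds, hx y₀] with y h1 h2 using h1 h2
    rw [eventually_nhdsWithin_iff] at h1 ⊢
    filter_upwards [(c.tendsto_symm hs).eventually h1, c.eventually_right_inverse' hs]
      with w hw hw' hne
    rw [hw'] at hw
    exact hw fun h => hne (by rw [← hw', h]; rfl)
  have hcont : ContinuousAt (Δ H) (c y₀) := by
    rw [laplacian_eq_iteratedFDeriv_complexPlane]
    have h2 := hH.continuousAt_iteratedFDeriv (k := 2) le_rfl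
    have h3 : ∀ v : Fin 2 → ℂ, ContinuousAt (fun w => iteratedFDeriv ℝ 2 H w v) (c y₀) := fun v =>
      (ContinuousMultilinearMap.apply ℝ (fun _ : Fin 2 => ℂ) ℝ v).continuous.continuousAt.comp h2
    exact (h3 _).add (h3 _)
  -- ΔH is continuous and vanishes on a punctured neighbourhood.
  have h0 : Δ H (c y₀) = 0 :=
    tendsto_nhds_unique_of_eventuallyEq (hcont.tendsto.mono_left nhdsWithin_le_nhds)
      tendsto_const_nhds hpunct
  rw [eventually_nhdsWithin_iff] at hpunct
  filter_upwards [hpunct] with w hw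
  rcases eq_or_ne w (c y₀) with rfl | hne
  · exact h0
  · exact hw hne

theorem IsGreenFunction.exists_sub_eq [ConnectedSpace X] (hG : IsGreenFunction μ α G) {x : X}
    (hx : ∀ y₀, ∀ᶠ y in 𝓝[≠] y₀, (x, y) ∉ μ.divisor) :
    ∃ C : ℝ, ∀ y, (x, y) ∉ μ.divisor → G x y - G y x = C := by
  choose H hH hE using hG.exists_harmonicAt hx
  -- The local extensions patch together: near each point they agree off the divisor, which meets
  -- the slice in isolated points.
  let u : X → ℝ := fun y => H y (chartAt ℂ y y)
  have hu : ∀ y₀ : X, ∃ H : ℂ → ℝ, HarmonicAt H (chartAt ℂ y₀ y₀) ∧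
      ∀ᶠ y in 𝓝 y₀, u y = H (chartAt ℂ y₀ y) := by
    intro y₀
    refine ⟨H y₀, hH y₀, ?_⟩
    have hs := mem_chart_source ℂ y₀
    filter_upwards [(hE y₀).eventually_nhds, (chartAt ℂ y₀).open_source.eventually_mem hs,
      ((chartAt ℂ y₀).continuousAt hs).eventually (hH y₀).eventually] with y hy hys hyH
    have c1 : ContinuousAt (fun y' => H y (chartAt ℂ y y')) y :=
      ContinuousAt.comp (g := H y) (hH y).1.continuousAt
        ((chartAt ℂ y).continuousAt (mem_chart_source ℂ y))
    have c2 : ContinuousAt (fun y' => H y₀ (chartAt ℂ y₀ y')) y :=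
      ContinuousAt.comp (g := H y₀) hyH.1.continuousAt ((chartAt ℂ y₀).continuousAt hys)
    have := neBot_nhdsNE y
    refine tendsto_nhds_unique_of_eventuallyEq (l := 𝓝[≠] y)
      (c1.tendsto.mono_left nhdsWithin_le_nhds)
      (c2.tendsto.mono_left nhdsWithin_le_nhds) ?_
    filter_upwards [hy.filter_mono nhdsWithin_le_nhds, (hE y).filter_mono nhdsWithin_le_nhds,
      hx y] with y' h1 h2 h3
    rw [← h1 h3, ← h2 h3]
  exact ⟨u x, fun y hy => ((hE y).self_of_nhds hy).trans (eq_of_forall_harmonicAt hu y x)⟩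

/-- Off the divisor G(x, y) - G(y, x) is antisymmetric and depends on x only, so for three points
C(x) = -C(y) = C(z) = -C(x). -/
theorem IsGreenFunction.symm [ConnectedSpace X] (hG : IsGreenFunction μ α G) (x y : X) :
    G x y = G y x := by
  by_cases hxy : (x, y) ∈ μ.divisor
  · rw [hG.eq_zero _ hxy, hG.eq_zero _ (AdmissibleCurrent.swap_mem_divisor hxy)]
  obtain ⟨B, hB, hdiv⟩ : ∃ B : Set X, B.Finite ∧ ∀ p q : X,
      (p, q) ∈ μ.divisor ↔ p = q ∨ p ∈ B ∨ q ∈ B := by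
    cases μ with
    | vol m => exact ⟨∅, Set.finite_empty, fun p q => by simp [AdmissibleCurrent.divisor]⟩
    | delta a => exact ⟨{a}, Set.finite_singleton a, fun p q => Iff.rfl⟩
  have hpunct : ∀ p, p ∉ B → ∀ y₀, ∀ᶠ q in 𝓝[≠] y₀, (p, q) ∉ μ.divisor := by
    intro p hp y₀
    have hfin : (insert p B \ {y₀}).Finite := (hB.insert p).subset Set.sdiff_subset
    rw [eventually_nhdsWithin_iff]
    filter_upwards [hfin.isClosed.isOpen_compl.eventually_mem (x := y₀) (by simp)] with q hq hne hd
    rcases (hdiv p q).1 hd with rfl | h | h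
    · exact hq ⟨.inl rfl, hne⟩
    · exact hp h
    · exact hq ⟨.inr h, hne⟩
  have := neBot_nhdsNE x
  -- X has no isolated points, hence is infinite, and a third point off the finite set `B` exists.
  obtain ⟨z, -, hz⟩ := (infinite_of_mem_nhds x Filter.univ_mem).exists_notMem_finite
    ((hB.insert x).insert y)
  simp only [hdiv, not_or, Set.mem_insert_iff] at hxy hz
  obtain ⟨C, hC⟩ := hG.exists_sub_eq (hpunct x hxy.2.1)
  obtain ⟨C', hC'⟩ := hG.exists_sub_eq (hpunct y hxy.2.2)
  obtain ⟨C'', hC''⟩ := hG.exists_sub_eq (hpunct z hz.2.2)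
  simp only [hdiv, not_or] at hC hC' hC''
  have h1 := hC y hxy
  have h2 := hC z ⟨Ne.symm hz.2.1, hxy.2.1, hz.2.2⟩
  have h3 := hC' x ⟨Ne.symm hxy.1, hxy.2.2, hxy.2.1⟩
  have h4 := hC' z ⟨Ne.symm hz.1, hxy.2.2, hz.2.2⟩
  have h5 := hC'' x ⟨hz.2.1, hz.2.2, hxy.2.1⟩
  have h6 := hC'' y ⟨hz.1, hz.2.2, hxy.2.2⟩
  linarith

end Green

end GreenSymmetry

/-! ### The Hodge correlator map -/

/-- As a reindexing by one permutation of all positions, the rearranged word is visibly multilinear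
in v. -/
theorem permuteTail_eq_comp {W : Type*} {n : ℕ} (v : Fin (n + 1) → W) (σ : Equiv.Perm (Fin n)) :
    permuteTail v σ = fun i => v (Equiv.Perm.decomposeFin.symm (0, σ) i) := by
  funext i
  refine Fin.cases ?_ (fun i => ?_) i <;> simp [permuteTail]

theorem tensorAlgebra_basis_apply {W κ : Type*} [AddCommGroup W] [Module ℂ W]
    (b : Module.Basis κ ℂ W) (w : FreeMonoid κ) :
    b.tensorAlgebra w = ((FreeMonoid.toList w).map fun k => TensorAlgebra.ι ℂ (b k)).prod := by
  have h : FreeAlgebra.basisFreeMonoid ℂ κ w = FreeMonoid.lift (FreeAlgebra.ι ℂ) w := by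
    simp [FreeAlgebra.basisFreeMonoid, FreeAlgebra.equivMonoidAlgebraFreeMonoid]
  rw [Module.Basis.tensorAlgebra, Module.Basis.map_apply, h]
  simp [FreeMonoid.lift_apply, Function.comp_def, map_list_prod]

section Cor

variable {X : Type*} [TopologicalSpace X] [ChartedSpace ℂ X]
  [CompactSpace X] [MeasurableSpace X] [BorelSpace X] {S : Finset X} {G : X → X → ℝ}

theorem corWord_cons (l : Letter S) (w : List (Letter S)) :
    corWord G (l :: w) = ∑ T ∈ PlaneTree.withEnds w, treeIntegral G l T :=
  PlaneTree.finsum_ends_eq (treeIntegral G l) w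

/-- The Hodge correlators of words satisfy the shuffle relations. -/
theorem sum_shuffles_corWord {p q : ℕ} (hp : 1 ≤ p) (hq : 1 ≤ q)
    (l : Fin (p + q + 1) → Letter S) :
    ∑ σ ∈ shuffles p q, corWord G (List.ofFn (permuteTail l σ)) = 0 := by
  rw [← sum_shuffles_withEnds (treeIntegral G (l 0))
    (fun T T' h => h.treeIntegral_eq G (l 0)) hp hq fun i => l i.succ]
  refine Finset.sum_congr rfl fun σ _ => ?_
  rw [List.ofFn_succ, corWord_cons]
  rfl

theorem corWord_rotate (hG : ∀ x y, G x y = G y x) (l : Letter S) (w : List (Letter S)) :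
    corWord G (w ++ [l]) = corWord G (l :: w) := by
  cases w with
  | nil => rfl
  | cons l' w =>
    rw [List.cons_append, corWord_cons, corWord_cons]
    exact (PlaneTree.sum_withEnds_rotate (treeIntegral G) (treeIntegral_rotate hG) l l' w).symm

/-- The Hodge correlator of a word depends only on the cyclic word. -/
theorem corWord_append_comm (hG : ∀ x y, G x y = G y x) (w w' : List (Letter S)) :
    corWord G (w ++ w') = corWord G (w' ++ w) := by
  induction w generalizing w' with
  | nil => simp
  | cons l w ih =>
    rw [List.cons_append, ← corWord_rotate hG, List.append_assoc, ih]
    simp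

variable {K : Type*} (b : Module.Basis K ℂ (OneForms X))

theorem cor_prod_basis (w : List (S ⊕ K)) :
    cor G b ((w.map fun k => TensorAlgebra.ι ℂ
      (((Finsupp.basisSingleOne (ι := S) (R := ℂ)).prod b) k)).prod) =
      corWord G (w.map (Sum.map id b)) := by
  have h := ((Finsupp.basisSingleOne (ι := S) (R := ℂ)).prod b).tensorAlgebra.constr_basis ℂ
    (fun w : FreeMonoid (S ⊕ K) => corWord G ((FreeMonoid.toList w).map (Sum.map id b)))
    (FreeMonoid.ofList w)
  rw [tensorAlgebra_basis_apply] at h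
  exact h

theorem cor_mul_comm (hG : ∀ x y, G x y = G y x) (x y : TensorAlgebra ℂ (VDual S)) :
    cor G b (x * y) = cor G b (y * x) := by
  let B := ((Finsupp.basisSingleOne (ι := S) (R := ℂ)).prod b).tensorAlgebra
  have h : (LinearMap.mul ℂ (TensorAlgebra ℂ (VDual S))).compr₂ (cor G b) =
      (LinearMap.mul ℂ (TensorAlgebra ℂ (VDual S))).flip.compr₂ (cor G b) := by
    refine LinearMap.ext_basis B B fun w w' => ?_
    simp only [LinearMap.compr₂_apply, LinearMap.mul_apply', LinearMap.flip_apply, B,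
      tensorAlgebra_basis_apply]
    rw [← List.prod_append, ← List.prod_append, ← List.map_append, ← List.map_append,
      cor_prod_basis, cor_prod_basis, List.map_append, List.map_append, corWord_append_comm hG]
  exact LinearMap.congr_fun₂ h x y

/-- The Hodge correlator map satisfies the shuffle relations. -/
theorem sum_shuffles_cor {p q : ℕ} (hp : 1 ≤ p) (hq : 1 ≤ q) (v : Fin (p + q + 1) → VDual S) :
    ∑ σ ∈ shuffles p q, cor G b (tensorWord (permuteTail v σ)).1 = 0 := by
  let B := (Finsupp.basisSingleOne (ι := S) (R := ℂ)).prod b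
  -- The shuffle sum is multilinear in v, so words in basis elements suffice.
  let M : MultilinearMap ℂ (fun _ : Fin (p + q + 1) => VDual S) ℂ :=
    ∑ σ ∈ shuffles p q, (cor G b).compMultilinearMap
      ((TensorAlgebra.tprod ℂ (VDual S) (p + q + 1)).domDomCongr
        (Equiv.Perm.decomposeFin.symm (0, σ)))
  have hM : ∀ v, M v = ∑ σ ∈ shuffles p q, cor G b (tensorWord (permuteTail v σ)).1 := by
    intro v
    simp only [M, sum_apply]
    refine Finset.sum_congr rfl fun σ _ => ?_
    rw [permuteTail_eq_comp]
    simp [tensorWord]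
  have h0 : M = 0 := by
    refine Module.Basis.ext_multilinear (fun _ => B) fun k => ?_
    rw [hM, zero_apply,
      ← sum_shuffles_corWord (G := G) hp hq fun i => Sum.map id b (k i)]
    refine Finset.sum_congr rfl fun σ _ => ?_
    have h := cor_prod_basis (G := G) b (List.ofFn (permuteTail k σ))
    rw [List.map_ofFn, List.map_ofFn] at h
    rw [permuteTail_eq_comp] at h ⊢
    rw [permuteTail_eq_comp]
    exact h
  rw [← hM, h0, zero_apply]

end Cor

end HodgeCorrelator

end

/-! ### Descent to the cyclic envelope and to its quotient by shuffles -/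

open HodgeCorrelator in
theorem proposition7p3p06p4
    {X : Type*} [TopologicalSpace X] [T2Space X] [CompactSpace X] [ConnectedSpace X]
    [ChartedSpace ℂ X] [IsManifold 𝓘(ℂ, ℂ) ω X] [MeasurableSpace X] [BorelSpace X]
    (S : Finset X) (μ : AdmissibleCurrent X)
    {g : ℕ} (α : Module.Basis (Fin g) ℂ (holForms X)) (hα : IsOrthonormal α)
    (G : X → X → ℝ) (hG : IsGreenFunction μ α G)
    {K : Type*} (b : Module.Basis K ℂ (OneForms X)) :
    (∀ p q : ℕ, 1 ≤ p → 1 ≤ q → ∀ l : Fin (p + q + 1) → Letter S,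
      ∑ σ ∈ shuffles p q, corWord G (List.ofFn (permuteTail l σ)) = 0) ∧
    ∃! Cor : CycEnv (VDual S) →ₗ[ℂ] ℂ,
      (∀ w : augIdeal (VDual S), Cor ((commutators (VDual S)).mkQ w) = cor G b w.1) ∧
      (∀ p q : ℕ, 1 ≤ p → 1 ≤ q → ∀ v : Fin (p + q + 1) → VDual S,
        ∑ σ ∈ shuffles p q, Cor (cycWord (permuteTail v σ)) = 0) ∧
      ∃! CorLie : CLie (VDual S) →ₗ[ℂ] ℂ,
        CorLie ∘ₗ (shuffleRelations (VDual S)).mkQ = Cor := by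
  refine ⟨fun p q hp hq l => sum_shuffles_corWord hp hq l, ?_⟩
  -- Cyclic invariance, and with it the symmetry of G, makes `cor` a trace.
  have hker : commutators (VDual S) ≤ LinearMap.ker (cor G b ∘ₗ (augIdeal (VDual S)).subtype) := by
    refine Submodule.span_le.2 ?_
    rintro c ⟨x, y, hc⟩
    simp only [SetLike.mem_coe, LinearMap.mem_ker, LinearMap.comp_apply, Submodule.subtype_apply]
    rw [hc, map_sub, cor_mul_comm b hG.symm, sub_self]
  let Cor : CycEnv (VDual S) →ₗ[ℂ] ℂ :=
    (commutators (VDual S)).liftQ (cor G b ∘ₗ (augIdeal (VDual S)).subtype) hker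
  have hCor : ∀ w : augIdeal (VDual S), Cor ((commutators (VDual S)).mkQ w) = cor G b w.1 :=
    fun w => rfl
  have hsh : ∀ p q : ℕ, 1 ≤ p → 1 ≤ q → ∀ v : Fin (p + q + 1) → VDual S,
      ∑ σ ∈ shuffles p q, Cor (cycWord (permuteTail v σ)) = 0 :=
    fun p q hp hq v => sum_shuffles_cor b hp hq v
  have hker' : shuffleRelations (VDual S) ≤ LinearMap.ker Cor := by
    refine Submodule.span_le.2 ?_
    rintro c ⟨p, q, hp, hq, v, rfl⟩
    simp only [SetLike.mem_coe, LinearMap.mem_ker, map_sum]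
    exact hsh p q hp hq v
  refine ⟨Cor, ⟨hCor, hsh, (shuffleRelations (VDual S)).liftQ Cor hker',
    Submodule.liftQ_mkQ _ _ _, fun C hC => ?_⟩, fun C hC => ?_⟩
  · exact Submodule.linearMap_qext _ (hC.trans (Submodule.liftQ_mkQ _ _ _).symm)
  · exact Submodule.linearMap_qext _ (LinearMap.ext fun w => (hC.1 w).trans (hCor w).symm)
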